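/- Let $\mathbb K$ be a field, $R=\mathbb K[x_0,\dots,x_n]$ with $x_0<\dots<x_n$ and the standard grading, and let $R^m(-\boldsymbol d)=\bigoplus_{k=1}^m R(-d_k)\mathbf e_k$ with $\boldsymbol d\in\mathbb Z^m$; its terms are the $x^{\alpha}\mathbf e_k$, of degree $|\alpha|+d_k$. The multiplicative variables of a term $x^\alpha\mathbf e_k$ are the variables $\le\min(x^\alpha)$, the smallest variable dividing $x^\alpha$ (all variables if $x^\alpha=1$, and we then put $\min(1)=x_n$); the cone of $x^\alpha\mathbf e_k$ is the set of its multiples by power products of its multiplicative variables. A Pommaret basis of a monomial submodule $U$ is a set of terms generating $U$ such that the set of terms in $U$ is the disjoint union of the cones of its elements; it is unique if it exists. $U$ is quasi-stable if it has a finite Pommaret basis $\mathcal P_U$, and stable if moreover $\mathcal P_U$ is the minimal set of term generators of $U$. Let $U\subseteq R^m(-\boldsymbol d)$ be quasi-stable. A $U$-marked set is a set $F=\{f_\tau\mid\tau\in\mathcal P_U\}$ of homogeneous elements of $R^m(-\boldsymbol d)$ such that the term $\tau$ (the head term) has coefficient $1$ in $f_\tau$ and all terms of $f_\tau-\tau$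 lie outside $U$. It is a $U$-marked basis if, for every $s$, $R^m(-\boldsymbol d)_s=(F)_s\oplus\langle\text{terms of degree } s \text{ outside } U\rangle_{\mathbb K}$. For a $U$-marked basis $F$, each $g\in(F)$ can be written uniquely as $g=\sum_\tau P_\tau f_\tau$ with $P_\tau\in R$ such that all terms of $P_\tau\cdot\tau$ lie in the cone of $\tau$. The fundamental syzygies of $F$ are the elements $x_i\mathbf f_\sigma-\sum_\tau P_\tau\mathbf f_\tau$ of the graded free module on symbols $\mathbf f_\tau$ with $\deg \mathbf f_\tau=\deg\tau$, one for each $\sigma\in\mathcal P_U$ and each non-multiplicative variable $x_i$ of $\sigma$, where $x_if_\sigma=\sum_\tau P_\tau f_\tau$ is this unique writing. They form, with head terms $x_i\mathbf f_\sigma$, a marked basis (over a stable module) of the module of syzygies of $F$. Iterating this construction gives a graded free resolution $$\cdots\to\bigoplus_j R(-j)^{r_{1,j}(U)}\xrightarrow{\partial_1}\bigoplus_j R(-j)^{r_{0,j}(U)}\xrightarrow{\partial_0}M\to0$$ of $M=(F)$, called the $U$-resolution of $M$, in which the columns of the matrix of $\partial_0$ are the elements of $F$, the columns of the matrix of $\partial_t$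 are the $t$-th fundamental syzygies, and $$r_{i,j}(U)=\sum_{q=0}^{n}\binom{n-q}{i}\,g_{j-i,q}(U),$$ where $g_{h,q}(U)$ is the number of terms $x^\alpha\mathbf e_k\in\mathcal P_U$ of degree $h$ with $\min(x^\alpha)=x_q$. A graded free resolution is minimal if no entry of the matrices of $\partial_t$, $t\ge1$, is invertible, and $\beta_{i,j}(M)$ denotes the graded Betti numbers of $M$, that is, the number of generators of degree $j$ of the $i$-th module of a minimal graded free resolution of $M$. **Corollary.** Let $U\subseteq R^m(-\boldsymbol d)$ be a quasi-stable module and $M\subseteq R^m(-\boldsymbol d)$ the module generated by a $U$-marked basis $F$. (i) The $U$-resolution of $M$ is a minimal resolution of $M$ if and only if $F$ is a minimal set of generators of $M$ (that is, no proper subset of $F$ generates $M$). (ii) If, for some $k\ge0$, $\beta_{k,j}(M)=r_{k,j}(U)$ for every $j$, then $\beta_{i,j}(M)=r_{i,j}(U)$ for every $i\ge k$ and every $j$. In particular, if $U$ is stable and, for some $k\ge 0$, $\beta_{k,j}(M)=\beta_{k,j}(U)$ for every $j$, then $\beta_{i,j}(M)=\beta_{i,j}(U)$ for every $i\ge k$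 and every $j$. -/

import Mathlib

noncomputable section

namespace MarkedBases

/-! ### Terms, degrees and multiplicative variables

The polynomial ring is `K[x_0, ..., x_n]` with `x_0 < ... < x_n`; the free module with basis
`(e_k)_{k : ι}` is `ι →₀ K[x_0, ..., x_n]`, graded by prescribing the degree `d k : ℤ` of `e_k`. -/

/-- The polynomial ring `K[x_0, ..., x_n]`. -/
abbrev Poly (n : ℕ) (K : Type*) [Field K] : Type _ := MvPolynomial (Fin (n + 1)) K

/-- The free module `⨁ k : ι, K[x_0, ..., x_n] e_k`. -/
abbrev Free (n : ℕ) (K : Type*) [Field K] (ι : Type) : Type _ := ι →₀ Poly n K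

/-- A term `x^α e_k`, given as the pair `(k, α)`. -/
abbrev Term (n : ℕ) (ι : Type) : Type := ι × (Fin (n + 1) →₀ ℕ)

/-- The term `x^α e_k` as an element of the free module. -/
def Term.toFree {n : ℕ} (K : Type*) [Field K] {ι : Type} (t : Term n ι) : Free n K ι :=
  Finsupp.single t.1 (MvPolynomial.monomial t.2 (1 : K))

/-- The degree `|α| + d_k` of the term `x^α e_k`. -/
def termDeg {n : ℕ} {ι : Type} (d : ι → ℤ) (t : Term n ι) : ℤ :=
  (t.2.degree : ℤ) + d t.1

/-- The homogeneous elements of degree `s` of the graded free module with basis degrees `d`. -/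
def gradedPiece {n : ℕ} {K : Type*} [Field K] {ι : Type} (d : ι → ℤ) (s : ℤ) :
    Submodule K (Free n K ι) where
  carrier := {f | ∀ k, ∀ α, (f k).coeff α ≠ 0 → termDeg d (k, α) = s}
  zero_mem' := by
    intro k α h
    simp at h
  add_mem' := by
    intro f g hf hg k α h
    by_cases h1 : (f k).coeff α = 0
    · by_cases h2 : (g k).coeff α = 0
      · simp [h1, h2] at h
      · exact hg k α h2
    · exact hf k α h1
  smul_mem' := by
    intro c f hf k α h
    apply hf k α
    intro h1
    simp [h1] at h

/-- `x_i` is a multiplicative variable of `x^α`: it is less than or equal to the smallest variable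
dividing `x^α`. All variables are multiplicative for `x^α = 1`. -/
def IsMultiplicative {n : ℕ} (α : Fin (n + 1) →₀ ℕ) (i : Fin (n + 1)) : Prop :=
  ∀ j ∈ α.support, i ≤ j

/-- The index `q` with `min(x^α) = x_q`. For `x^α = 1`, all of whose variables are multiplicative,
it is `n`. -/
def minIndex {n : ℕ} (α : Fin (n + 1) →₀ ℕ) : Fin (n + 1) :=
  if h : α.support.Nonempty then α.support.min' h else Fin.last n

/-! ### Pommaret bases, quasi-stable and stable modules -/

/-- The Pommaret cone of a term: its multiples by power products of multiplicative variables. -/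
def pommaretCone {n : ℕ} {ι : Type} (t : Term n ι) : Set (Term n ι) :=
  {u | ∃ δ : Fin (n + 1) →₀ ℕ, (∀ i, δ i ≠ 0 → IsMultiplicative t.2 i) ∧ u = (t.1, δ + t.2)}

/-- `U` is generated by terms. -/
def IsMonomial {n : ℕ} {K : Type*} [Field K] {ι : Type}
    (U : Submodule (Poly n K) (Free n K ι)) : Prop :=
  ∃ T : Set (Term n ι), U = Submodule.span (Poly n K) (Term.toFree K '' T)

/-- `T` is a Pommaret basis of `U`: it generates `U`, and the set of terms in `U` is the disjoint
union of the Pommaret cones of the elements of `T`. -/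
structure IsPommaretBasis {n : ℕ} {K : Type*} [Field K] {ι : Type}
    (U : Submodule (Poly n K) (Free n K ι)) (T : Set (Term n ι)) : Prop where
  span_eq : Submodule.span (Poly n K) (Term.toFree K '' T) = U
  terms_eq : {t : Term n ι | t.toFree K ∈ U} = ⋃ t ∈ T, pommaretCone t
  disjoint : T.PairwiseDisjoint pommaretCone

/-- A quasi-stable module is a monomial module with a finite Pommaret basis. -/
def IsQuasiStable {n : ℕ} {K : Type*} [Field K] {ι : Type}
    (U : Submodule (Poly n K) (Free n K ι)) : Prop :=
  IsMonomial U ∧ ∃ T : Finset (Term n ι), IsPommaretBasis U (T : Set (Term n ι))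

open Classical in
/-- The (unique) finite Pommaret basis of a quasi-stable module; the empty set if there is none. -/
def pommaretBasis {n : ℕ} {K : Type*} [Field K] {ι : Type}
    (U : Submodule (Poly n K) (Free n K ι)) : Finset (Term n ι) :=
  if h : ∃ T : Finset (Term n ι), IsPommaretBasis U (T : Set (Term n ι)) then h.choose else ∅

theorem IsQuasiStable.isPommaretBasis {n : ℕ} {K : Type*} [Field K] {ι : Type}
    {U : Submodule (Poly n K) (Free n K ι)} (hU : IsQuasiStable U) :
    IsPommaretBasis U (pommaretBasis U : Set (Term n ι)) := by
  unfold pommaretBasis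
  rw [dif_pos hU.2]
  exact hU.2.choose_spec

theorem mem_pommaretCone_self {n : ℕ} {ι : Type} (t : Term n ι) : t ∈ pommaretCone t :=
  ⟨0, by simp, by simp⟩

theorem pommaretCone_trans {n : ℕ} {ι : Type} {t u v : Term n ι}
    (h₁ : t ∈ pommaretCone u) (h₂ : u ∈ pommaretCone v) : t ∈ pommaretCone v := by
  obtain ⟨δ, hδ, rfl⟩ := h₁
  obtain ⟨ε, hε, rfl⟩ := h₂
  refine ⟨δ + ε, ?_, by simp [add_assoc]⟩
  intro i hi
  by_cases h : ε i = 0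
  · have h0 : δ i ≠ 0 := by simpa [h] using hi
    intro j hj
    refine hδ i h0 j ?_
    simp only [Finsupp.mem_support_iff, Finsupp.add_apply] at hj ⊢
    omega
  · exact hε i h

theorem IsPommaretBasis.subset {n : ℕ} {K : Type*} [Field K] {ι : Type}
    {U : Submodule (Poly n K) (Free n K ι)} {S T : Set (Term n ι)}
    (hS : IsPommaretBasis U S) (hT : IsPommaretBasis U T) : S ⊆ T := by
  intro t ht
  have h1 : t ∈ ⋃ t ∈ T, pommaretCone t := by
    rw [← hT.terms_eq, hS.terms_eq]
    exact Set.mem_biUnion ht (mem_pommaretCone_self t)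
  obtain ⟨u, hu, htu⟩ := Set.mem_iUnion₂.1 h1
  have h2 : u ∈ ⋃ t ∈ S, pommaretCone t := by
    rw [← hS.terms_eq, hT.terms_eq]
    exact Set.mem_biUnion hu (mem_pommaretCone_self u)
  obtain ⟨v, hv, huv⟩ := Set.mem_iUnion₂.1 h2
  have htv := pommaretCone_trans htu huv
  have hvt : v = t := by
    by_contra hne
    exact Set.disjoint_left.1 (hS.disjoint hv ht hne) htv (mem_pommaretCone_self t)
  subst hvt
  have huv' : u = v := by
    obtain ⟨δ, -, h3⟩ := htu
    obtain ⟨ε, -, h4⟩ := huv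
    have h5 : v.2 = δ + u.2 := congrArg Prod.snd h3
    have h6 : u.2 = ε + v.2 := congrArg Prod.snd h4
    have h7 : v.1 = u.1 := by rw [h3]
    refine Prod.ext h7.symm ?_
    ext i
    have h8 := DFunLike.congr_fun h5 i
    have h9 := DFunLike.congr_fun h6 i
    simp only [Finsupp.add_apply] at h8 h9
    omega
  exact huv' ▸ hu

/-- The Pommaret basis is unique. -/
theorem IsPommaretBasis.unique {n : ℕ} {K : Type*} [Field K] {ι : Type}
    {U : Submodule (Poly n K) (Free n K ι)} {S T : Set (Term n ι)}
    (hS : IsPommaretBasis U S) (hT : IsPommaretBasis U T) : S = T :=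
  (hS.subset hT).antisymm (hT.subset hS)

/-- The monomial basis of a monomial module: the terms of `U` that are minimal for divisibility. -/
def monomialBasis {n : ℕ} {K : Type*} [Field K] {ι : Type}
    (U : Submodule (Poly n K) (Free n K ι)) : Set (Term n ι) :=
  {t | t.toFree K ∈ U ∧ ∀ s : Term n ι, s.toFree K ∈ U → s.1 = t.1 → s.2 ≤ t.2 → s = t}

/-- A quasi-stable module is stable if its Pommaret basis is its monomial basis. -/
def IsStable {n : ℕ} {K : Type*} [Field K] {ι : Type}
    (U : Submodule (Poly n K) (Free n K ι)) : Prop :=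
  IsQuasiStable U ∧ (pommaretBasis U : Set (Term n ι)) = monomialBasis U

/-! ### Marked bases -/

/-- The terms of degree `s` outside `U` span this `K`-subspace. -/
def sousEscalierSpan {n : ℕ} {K : Type*} [Field K] {ι : Type} (d : ι → ℤ)
    (U : Submodule (Poly n K) (Free n K ι)) (s : ℤ) : Submodule K (Free n K ι) :=
  Submodule.span K (Term.toFree K '' {t | t.toFree K ∉ U ∧ termDeg d t = s})

/-- A `U`-marked set, indexed by its head terms: for every term `x^α e_k` in the Pommaret basis of
`U` a homogeneous element in which `x^α e_k` has coefficient one, all other terms being outside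
`U`. -/
structure IsMarkedSet {n : ℕ} {K : Type*} [Field K] {ι : Type} (d : ι → ℤ)
    (U : Submodule (Poly n K) (Free n K ι))
    (F : {t : Term n ι // t ∈ pommaretBasis U} → Free n K ι) : Prop where
  homogeneous : ∀ t, ∃ s, F t ∈ gradedPiece d s
  head_coeff : ∀ t, (F t t.1.1).coeff t.1.2 = 1
  tail : ∀ t, ∀ k β, ((F t - t.1.toFree K) k).coeff β ≠ 0 → Term.toFree K (k, β) ∉ U

/-- A `U`-marked basis: a `U`-marked set `F` such that, in each degree `s`, the free module is the
direct sum of `(F)_s` and of the span of the terms of degree `s` outside `U`. -/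
structure IsMarkedBasis {n : ℕ} {K : Type*} [Field K] {ι : Type} (d : ι → ℤ)
    (U : Submodule (Poly n K) (Free n K ι))
    (F : {t : Term n ι // t ∈ pommaretBasis U} → Free n K ι) : Prop
    extends IsMarkedSet d U F where
  disjoint : ∀ s, Disjoint
    ((Submodule.span (Poly n K) (Set.range F)).restrictScalars K ⊓ gradedPiece d s)
    (sousEscalierSpan d U s)
  sup_eq : ∀ s,
    ((Submodule.span (Poly n K) (Set.range F)).restrictScalars K ⊓ gradedPiece d s) ⊔
      sousEscalierSpan d U s = gradedPiece d s

/-- `S` generates `M` and no proper subset of `S` does. -/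
def IsMinimalGeneratingSet {n : ℕ} {K : Type*} [Field K] {ι : Type}
    (M : Submodule (Poly n K) (Free n K ι)) (S : Set (Free n K ι)) : Prop :=
  Submodule.span (Poly n K) S = M ∧ ∀ T, T ⊂ S → Submodule.span (Poly n K) T ≠ M

/-! ### Graded free resolutions and Betti numbers -/

/-- The data of a sequence `⋯ → G_1 → G_0 → ⨁ k : ι, K[x_0, ..., x_n] e_k` of graded free modules:
the module `G_i` has the basis `idx i` with degrees `deg i`, the last map is given by the images
`aug a` of the basis elements, and `diff i a` is the image in `G_i` of the basis element `a` of
`G_{i+1}`, that is, a column of the matrix of `G_{i+1} → G_i`. -/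
structure FreeSequence (n : ℕ) (K : Type*) [Field K] (ι : Type) where
  idx : ℕ → Type
  deg : ∀ i, idx i → ℤ
  aug : idx 0 → Free n K ι
  diff : ∀ i, idx (i + 1) → Free n K (idx i)

namespace FreeSequence

variable {n : ℕ} {K : Type*} [Field K] {ι : Type}

/-- The map from `G_0` to the free module with basis `ι`. -/
def augMap (C : FreeSequence n K ι) : Free n K (C.idx 0) →ₗ[Poly n K] Free n K ι :=
  Finsupp.linearCombination (Poly n K) C.aug

/-- The map from `G_{i+1}` to `G_i`. -/
def diffMap (C : FreeSequence n K ι) (i : ℕ) :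
    Free n K (C.idx (i + 1)) →ₗ[Poly n K] Free n K (C.idx i) :=
  Finsupp.linearCombination (Poly n K) (C.diff i)

/-- `C` is a graded resolution by finitely generated free modules of the submodule `M` of the graded
free module with basis degrees `d`: all maps are homogeneous of degree zero, and
`⋯ → G_1 → G_0 → M → 0` is exact. -/
structure IsResolution (C : FreeSequence n K ι) (d : ι → ℤ)
    (M : Submodule (Poly n K) (Free n K ι)) : Prop where
  finite : ∀ i, Finite (C.idx i)
  aug_homogeneous : ∀ a, C.aug a ∈ gradedPiece d (C.deg 0 a)
  diff_homogeneous : ∀ i a, C.diff i a ∈ gradedPiece (C.deg i) (C.deg (i + 1) a)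
  range_aug : LinearMap.range C.augMap = M
  exact_zero : LinearMap.range (C.diffMap 0) = LinearMap.ker C.augMap
  exact_succ : ∀ i, LinearMap.range (C.diffMap (i + 1)) = LinearMap.ker (C.diffMap i)

/-- `C` is a minimal graded free resolution of `M`: no matrix `G_{i+1} → G_i` has an invertible
entry. -/
structure IsMinimalResolution (C : FreeSequence n K ι) (d : ι → ℤ)
    (M : Submodule (Poly n K) (Free n K ι)) : Prop extends C.IsResolution d M where
  minimal : ∀ i a b, ¬ IsUnit (C.diff i a b)

/-- The number of basis elements of degree `j` of `G_i`. -/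
def rank (C : FreeSequence n K ι) (i : ℕ) (j : ℤ) : ℕ :=
  Nat.card {a : C.idx i // C.deg i a = j}

end FreeSequence

open Classical in
/-- The graded Betti number `β_{i,j}(M)`: the number of generators of degree `j` of the `i`-th
module of a minimal graded free resolution of `M`. -/
def bettiNumber {n : ℕ} {K : Type*} [Field K] {ι : Type} (d : ι → ℤ)
    (M : Submodule (Poly n K) (Free n K ι)) (i : ℕ) (j : ℤ) : ℕ :=
  if h : ∃ C : FreeSequence n K ι, C.IsMinimalResolution d M then h.choose.rank i j else 0

/-! ### The `U`-resolution -/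

/-- A family of elements `elt p` of the graded free module with basis `base` and degrees
`baseDeg`, together with head terms `head p`. -/
structure MarkedFamily (n : ℕ) (K : Type*) [Field K] where
  base : Type
  baseDeg : base → ℤ
  idx : Type
  head : idx → Term n base
  elt : idx → Free n K base

namespace MarkedFamily

variable {n : ℕ} {K : Type*} [Field K]

/-- `g = ∑ p, P_p f_p` where the terms of `P_p` times the head term of `f_p` lie in the Pommaret cone
of that head term. -/
def IsWriting (D : MarkedFamily n K) (g : Free n K D.base) (P : Free n K D.idx) : Prop :=
  (∀ p, ∀ η, (P p).coeff η ≠ 0 →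
    ((D.head p).1, η + (D.head p).2) ∈ pommaretCone (D.head p)) ∧
  Finsupp.linearCombination (Poly n K) D.elt P = g

open Classical in
/-- The coefficients `(P_p)` of the writing of `g` (unique for a marked basis), zero if there is
none. -/
def writing (D : MarkedFamily n K) (g : Free n K D.base) : Free n K D.idx :=
  if h : ∃ P, D.IsWriting g P then h.choose else 0

/-- The fundamental syzygy `x_i f_p - ∑ q, P_q f_q` (in the free module on the symbols `f_q`), where
`∑ q, P_q f_q` is the writing of `x_i f_p`. -/
def fundamentalSyzygy (D : MarkedFamily n K) (i : Fin (n + 1)) (p : D.idx) : Free n K D.idx :=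
  Finsupp.single p (MvPolynomial.X i) - D.writing ((MvPolynomial.X i : Poly n K) • D.elt p)

/-- The family of all fundamental syzygies, one for each element `f_p` and each non-multiplicative
variable `x_i` of its head term, with head terms `x_i f_p`. -/
def syzygies (D : MarkedFamily n K) : MarkedFamily n K where
  base := D.idx
  baseDeg p := termDeg D.baseDeg (D.head p)
  idx := {q : Fin (n + 1) × D.idx // ¬ IsMultiplicative (D.head q.2).2 q.1}
  head q := (q.1.2, Finsupp.single q.1.1 1)
  elt q := D.fundamentalSyzygy q.1.1 q.1.2

/-- The family of `t`-th fundamental syzygies. -/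
def iterSyzygies (D : MarkedFamily n K) : ℕ → MarkedFamily n K
  | 0 => D
  | t + 1 => (D.iterSyzygies t).syzygies

/-- The sequence of free modules and maps obtained by iterating fundamental syzygies. -/
def resolution (D : MarkedFamily n K) : FreeSequence n K D.base where
  idx t := (D.iterSyzygies t).idx
  deg t p := termDeg (D.iterSyzygies t).baseDeg ((D.iterSyzygies t).head p)
  aug := D.elt
  diff t := (D.iterSyzygies (t + 1)).elt

end MarkedFamily

/-- The `U`-resolution of the module generated by the `U`-marked basis `F`. -/
def uResolution {n : ℕ} {K : Type*} [Field K] {ι : Type} (d : ι → ℤ)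
    (U : Submodule (Poly n K) (Free n K ι))
    (F : {t : Term n ι // t ∈ pommaretBasis U} → Free n K ι) : FreeSequence n K ι :=
  MarkedFamily.resolution
    { base := ι
      baseDeg := d
      idx := {t : Term n ι // t ∈ pommaretBasis U}
      head := Subtype.val
      elt := F }

/-- The number of terms `x^α e_k` of degree `h` in the Pommaret basis of `U` with
`min(x^α) = x_q`. -/
def pommaretCount {n : ℕ} {K : Type*} [Field K] {ι : Type} (d : ι → ℤ)
    (U : Submodule (Poly n K) (Free n K ι)) (h : ℤ) (q : Fin (n + 1)) : ℕ :=
  Set.ncard {t : Term n ι | t ∈ pommaretBasis U ∧ termDeg d t = h ∧ minIndex t.2 = q}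

/-- The Betti numbers `r_{i,j}(U)` of the `U`-resolution. -/
def uBetti {n : ℕ} {K : Type*} [Field K] {ι : Type} (d : ι → ℤ)
    (U : Submodule (Poly n K) (Free n K ι)) (i : ℕ) (j : ℤ) : ℕ :=
  ∑ q : Fin (n + 1), (n - (q : ℕ)).choose i * pommaretCount d U (j - i) q

end MarkedBases

end

open MarkedBases

open MvPolynomial

noncomputable section

namespace MarkedBases

/-! ### Terms as a basis of the free module over the field -/

section Terms

variable {n : ℕ} {K : Type*} [Field K] {κ : Type}

/-! Everything is read off from the constant coefficients of the matrices. In a homogeneous column,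
an entry with nonzero constant coefficient is a nonzero scalar (`eq_C_of_constantCoeff_ne_zero`), so
a resolution is minimal exactly when its matrices vanish modulo the variables.

The heart is propagation (`constantCoeff_syzygies_syzygies`): if one matrix of the `U`-resolution
vanishes modulo the variables, so does the next. Let `s_p` be the fundamental syzygies of one step;
a syzygy of the next step comes from `x_j s_q = ∑ P_p s_p`. The head term `x_i f_σ` of `s_b` occurs
in no other `s_p`. If no `s_p` has a constant coefficient, comparing the coefficients of this term
gives the constant coefficient of `P_b` on the right and zero on the left. Hence one vanishing
matrix forces all later ones to vanish.

For (i), propagation leaves only the first matrix, whose columns generate the relations of `F`. A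
homogeneous relation with a nonzero constant coefficient can be solved for one generator, and a
redundant generator gives such a relation (`isMinimalGeneratingSet_iff`).

For (ii), the `U`-resolution is compared with a minimal one. Equal ranks in position `k` make the
comparison map invertible modulo the variables there, which forces the matrix into position `k` to
vanish (`constMatrix_eq_zero_of_rank_eq`). Propagation then gives all later matrices, and
resolutions vanishing modulo the variables on both sides of a position have equal ranks there
(`rank_eq`). If `U` is stable, its Pommaret basis is itself a marked basis and a minimal generating
set, so the Betti numbers of `U` are the `r_{i,j}(U)`.

The iteration rests on `IsMarked.syzygies`: the fundamental syzygies of a marked family form a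
marked family again. -/

/-- The terms form a basis of the free module over the field of coefficients. -/
def termBasis (n : ℕ) (K : Type*) [Field K] (κ : Type) :
    Module.Basis (Term n κ) K (Free n K κ) :=
  (Finsupp.basis fun _ : κ => MvPolynomial.basisMonomials (Fin (n + 1)) K).reindex
    (Equiv.sigmaEquivProd _ _)

theorem termBasis_apply (t : Term n κ) : termBasis n K κ t = t.toFree K := by
  simp [termBasis, Finsupp.coe_basis, Term.toFree, Equiv.sigmaEquivProd]

theorem termBasis_repr (f : Free n K κ) (t : Term n κ) :
    (termBasis n K κ).repr f t = (f t.1).coeff t.2 := by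
  rw [termBasis, Module.Basis.repr_reindex_apply, Finsupp.basis_repr]
  rfl

theorem coeff_toFree_self (t : Term n κ) : (t.toFree K t.1).coeff t.2 = 1 := by
  simp [Term.toFree]

theorem coeff_toFree_of_ne {t : Term n κ} {k : κ} {α : Fin (n + 1) →₀ ℕ} (h : t ≠ (k, α)) :
    (t.toFree K k).coeff α = 0 := by
  classical
  unfold Term.toFree
  by_cases hk : t.1 = k
  · subst hk
    rw [Finsupp.single_eq_same, coeff_monomial, if_neg]
    rintro rfl
    exact h rfl
  · rw [Finsupp.single_eq_of_ne (Ne.symm hk), coeff_zero]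

theorem free_ext {f g : Free n K κ} (h : ∀ k α, (f k).coeff α = (g k).coeff α) : f = g := by
  ext k α
  exact h k α

/-- The elements all of whose terms lie in `A`. -/
def termsIn (K : Type*) [Field K] (A : Set (Term n κ)) : Submodule K (Free n K κ) where
  carrier := {f | ∀ k, ∀ α, (f k).coeff α ≠ 0 → (k, α) ∈ A}
  zero_mem' := by
    intro k α h
    simp at h
  add_mem' := by
    intro f g hf hg k α h
    by_cases h1 : (f k).coeff α = 0
    · by_cases h2 : (g k).coeff α = 0
      · simp [h1, h2] at h
      · exact hg k α h2
    · exact hf k α h1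
  smul_mem' := by
    intro c f hf k α h
    apply hf k α
    intro h1
    simp [h1] at h

theorem coeff_eq_zero_of_mem_termsIn {A : Set (Term n κ)} {f : Free n K κ} (hf : f ∈ termsIn K A)
    {k : κ} {α : Fin (n + 1) →₀ ℕ} (h : (k, α) ∉ A) : (f k).coeff α = 0 := by
  by_contra h1
  exact h (hf k α h1)

theorem gradedPiece_eq_termsIn (d : κ → ℤ) (s : ℤ) :
    gradedPiece (n := n) (K := K) d s = termsIn K {t | termDeg d t = s} := rfl

theorem termsIn_mono {A B : Set (Term n κ)} (h : A ⊆ B) : termsIn K A ≤ termsIn K B :=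
  fun _ hf k α hc => h (hf k α hc)

theorem termsIn_inter (A B : Set (Term n κ)) :
    termsIn K (A ∩ B) = termsIn K A ⊓ termsIn K B := by
  ext f
  exact ⟨fun h => ⟨fun k α hc => (h k α hc).1, fun k α hc => (h k α hc).2⟩,
    fun h k α hc => ⟨h.1 k α hc, h.2 k α hc⟩⟩

theorem toFree_mem_termsIn {A : Set (Term n κ)} {t : Term n κ} (h : t ∈ A) :
    t.toFree K ∈ termsIn K A := by
  intro k α hc
  by_cases ht : t = (k, α)
  · exact ht ▸ h
  · exact absurd (coeff_toFree_of_ne ht) hc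

theorem toFree_mem_termsIn_iff {A : Set (Term n κ)} {t : Term n κ} :
    t.toFree K ∈ termsIn K A ↔ t ∈ A :=
  ⟨fun h => h t.1 t.2 (by rw [coeff_toFree_self]; exact one_ne_zero), toFree_mem_termsIn⟩

theorem termsIn_eq_span (A : Set (Term n κ)) :
    termsIn K A = Submodule.span K (Term.toFree K '' A) := by
  apply le_antisymm
  · intro f hf
    rw [← (termBasis n K κ).linearCombination_repr f, Finsupp.linearCombination_apply]
    refine Submodule.sum_mem _ fun t ht => Submodule.smul_mem _ _ ?_
    rw [termBasis_apply]
    refine Submodule.subset_span ⟨t, hf t.1 t.2 ?_, rfl⟩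
    rw [← termBasis_repr]
    exact Finsupp.mem_support_iff.1 ht
  · rw [Submodule.span_le]
    rintro _ ⟨t, ht, rfl⟩
    exact toFree_mem_termsIn ht

/-- The terms are a `K`-basis, so membership in a `K`-subspace, also through preimages under
`K`-linear maps, need only be tested on terms. Most inclusions below are proved this way. -/
theorem termsIn_le_iff {A : Set (Term n κ)} {W : Submodule K (Free n K κ)} :
    termsIn K A ≤ W ↔ ∀ t ∈ A, t.toFree K ∈ W := by
  rw [termsIn_eq_span, Submodule.span_le, Set.image_subset_iff]
  rfl

theorem termsIn_univ : termsIn K (Set.univ : Set (Term n κ)) = ⊤ :=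
  eq_top_iff.2 fun _ _ _ _ _ => trivial

theorem monomial_smul_toFree (η : Fin (n + 1) →₀ ℕ) (t : Term n κ) :
    (monomial η (1 : K)) • t.toFree K = Term.toFree K (t.1, η + t.2) := by
  simp [Term.toFree, monomial_mul]

theorem linearCombination_toFree {M : Type*} [AddCommGroup M] [Module (Poly n K) M] (v : κ → M)
    (t : Term n κ) :
    Finsupp.linearCombination (Poly n K) v (t.toFree K) = (monomial t.2 (1 : K)) • v t.1 := by
  simp [Term.toFree]

theorem monomial_smul_mem {A : Set (Term n κ)} {W : Submodule K (Free n K κ)}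
    {η : Fin (n + 1) →₀ ℕ} (h : ∀ t ∈ A, Term.toFree K (t.1, η + t.2) ∈ W) {f : Free n K κ}
    (hf : f ∈ termsIn K A) : (monomial η (1 : K)) • f ∈ W := by
  have key : termsIn K A ≤ W.comap ((LinearMap.lsmul (Poly n K) (Free n K κ)
      (monomial η (1 : K))).restrictScalars K) := by
    rw [termsIn_le_iff]
    intro t ht
    change (monomial η (1 : K)) • t.toFree K ∈ W
    rw [monomial_smul_toFree]
    exact h t ht
  exact key hf

/-- Multiplication by a power product moves the terms. -/
theorem monomial_smul_mem_termsIn {A B : Set (Term n κ)} {η : Fin (n + 1) →₀ ℕ}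
    (h : ∀ t ∈ A, (t.1, η + t.2) ∈ B) {f : Free n K κ} (hf : f ∈ termsIn K A) :
    (monomial η (1 : K)) • f ∈ termsIn K B :=
  monomial_smul_mem (fun t ht => toFree_mem_termsIn (h t ht)) hf

/-- If `A` is closed under multiplication by power products, the elements with terms in `A` form a
submodule over the polynomial ring. -/
theorem smul_mem_termsIn {A : Set (Term n κ)}
    (h : ∀ t ∈ A, ∀ η : Fin (n + 1) →₀ ℕ, (t.1, η + t.2) ∈ A) (p : Poly n K) {f : Free n K κ}
    (hf : f ∈ termsIn K A) : p • f ∈ termsIn K A := by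
  induction p using MvPolynomial.induction_on' with
  | monomial η c =>
    have : monomial η c = c • monomial η (1 : K) := by simp [smul_monomial]
    rw [this, smul_assoc]
    exact Submodule.smul_mem _ _ (monomial_smul_mem_termsIn (fun t ht => h t ht η) hf)
  | add p q hp hq =>
    rw [add_smul]
    exact add_mem hp hq

theorem linearCombination_mem {μ : Type} {A : Set (Term n μ)} {W : Submodule K (Free n K κ)}
    {v : μ → Free n K κ} (h : ∀ t ∈ A, (monomial t.2 (1 : K)) • v t.1 ∈ W) {P : Free n K μ}
    (hP : P ∈ termsIn K A) : Finsupp.linearCombination (Poly n K) v P ∈ W := by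
  have key : termsIn K A ≤
      W.comap ((Finsupp.linearCombination (Poly n K) v).restrictScalars K) := by
    rw [termsIn_le_iff]
    intro t ht
    change Finsupp.linearCombination (Poly n K) v (t.toFree K) ∈ W
    rw [linearCombination_toFree]
    exact h t ht
  exact key hP

theorem termDeg_add (d : κ → ℤ) (k : κ) (η α : Fin (n + 1) →₀ ℕ) :
    termDeg d (k, η + α) = (η.degree : ℤ) + termDeg d (k, α) := by
  simp [termDeg, add_assoc]

theorem monomial_smul_mem_gradedPiece {d : κ → ℤ} {s : ℤ} {f : Free n K κ}
    (hf : f ∈ gradedPiece d s) (η : Fin (n + 1) →₀ ℕ) :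
    (monomial η (1 : K)) • f ∈ gradedPiece d ((η.degree : ℤ) + s) := by
  rw [gradedPiece_eq_termsIn] at hf ⊢
  refine monomial_smul_mem_termsIn ?_ hf
  intro t ht
  change termDeg d _ = _
  rw [termDeg_add, show termDeg d t = s from ht]

theorem linearCombination_mem_gradedPiece {μ : Type} {d : κ → ℤ} {e : μ → ℤ} {v : μ → Free n K κ}
    (hv : ∀ a, v a ∈ gradedPiece d (e a)) {s : ℤ} {P : Free n K μ} (hP : P ∈ gradedPiece e s) :
    Finsupp.linearCombination (Poly n K) v P ∈ gradedPiece d s := by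
  refine linearCombination_mem (A := {t | termDeg e t = s}) ?_ hP
  intro t ht
  have := monomial_smul_mem_gradedPiece (hv t.1) t.2
  rwa [show (t.2.degree : ℤ) + e t.1 = s from ht] at this

theorem coeff_eq_zero_of_mem_gradedPiece {d : κ → ℤ} {s : ℤ} {f : Free n K κ}
    (hf : f ∈ gradedPiece d s) {k : κ} {α : Fin (n + 1) →₀ ℕ} (h : termDeg d (k, α) ≠ s) :
    (f k).coeff α = 0 := by
  by_contra h1
  exact h (hf k α h1)

theorem toFree_mem_gradedPiece (d : κ → ℤ) (t : Term n κ) :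
    t.toFree K ∈ gradedPiece d (termDeg d t) :=
  toFree_mem_termsIn (A := {u | termDeg d u = termDeg d t}) rfl

/-! ### Homogeneous components -/

open Classical in
/-- The homogeneous component of degree `s`. -/
def homComp (d : κ → ℤ) (s : ℤ) : Free n K κ →ₗ[K] Free n K κ :=
  (termBasis n K κ).constr K fun t => if termDeg d t = s then t.toFree K else 0

open Classical in
theorem homComp_toFree (d : κ → ℤ) (s : ℤ) (t : Term n κ) :
    homComp d s (t.toFree K) = if termDeg d t = s then t.toFree K else 0 := by
  conv_lhs => rw [← termBasis_apply, homComp, Module.Basis.constr_basis]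

theorem homComp_of_mem {d : κ → ℤ} {s : ℤ} {f : Free n K κ} (hf : f ∈ gradedPiece d s) :
    homComp d s f = f := by
  classical
  have key : gradedPiece d s ≤ LinearMap.eqLocus (homComp (K := K) (n := n) d s) LinearMap.id := by
    rw [gradedPiece_eq_termsIn, termsIn_le_iff]
    intro t ht
    rw [LinearMap.mem_eqLocus, homComp_toFree, if_pos (show termDeg d t = s from ht),
      LinearMap.id_apply]
  exact key hf

theorem homComp_of_mem_of_ne {d : κ → ℤ} {s u : ℤ} {f : Free n K κ} (hf : f ∈ gradedPiece d u)
    (h : u ≠ s) : homComp d s f = 0 := by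
  classical
  have key : gradedPiece d u ≤ LinearMap.ker (homComp (K := K) (n := n) d s) := by
    rw [gradedPiece_eq_termsIn, termsIn_le_iff]
    intro t ht
    rw [LinearMap.mem_ker, homComp_toFree, if_neg]
    rw [show termDeg d t = u from ht]
    exact h
  exact key hf

theorem homComp_mem (d : κ → ℤ) (s : ℤ) (f : Free n K κ) : homComp d s f ∈ gradedPiece d s := by
  classical
  have key : termsIn K (Set.univ : Set (Term n κ)) ≤ (gradedPiece d s).comap (homComp d s) := by
    rw [termsIn_le_iff]
    intro t _
    rw [Submodule.mem_comap, homComp_toFree]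
    split_ifs with h
    · exact h ▸ toFree_mem_gradedPiece d t
    · exact zero_mem _
  exact key (termsIn_univ (K := K) ▸ Submodule.mem_top)

theorem coeff_homComp {d : κ → ℤ} {s : ℤ} {k : κ} {α : Fin (n + 1) →₀ ℕ}
    (h : termDeg d (k, α) = s) (f : Free n K κ) : (homComp d s f k).coeff α = (f k).coeff α := by
  classical
  have key : (MvPolynomial.lcoeff K α ∘ₗ Finsupp.lapply k) ∘ₗ homComp (K := K) d s =
      MvPolynomial.lcoeff K α ∘ₗ Finsupp.lapply k := by
    refine (termBasis n K κ).ext fun t => ?_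
    rw [LinearMap.comp_apply, termBasis_apply, homComp_toFree]
    split_ifs with ht
    · rfl
    · rw [map_zero]
      refine (coeff_toFree_of_ne (K := K) ?_).symm
      rintro rfl
      exact ht h
  exact LinearMap.congr_fun key f

theorem exists_sum_homComp (d : κ → ℤ) (f : Free n K κ) :
    ∃ S : Finset ℤ, f = ∑ s ∈ S, homComp d s f := by
  classical
  refine ⟨((termBasis n K κ).repr f).support.image (termDeg d), free_ext fun k α => ?_⟩
  rw [Finsupp.finsetSum_apply, MvPolynomial.coeff_sum]
  by_cases hc : (f k).coeff α = 0
  · rw [hc, Finset.sum_eq_zero]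
    intro s _
    by_cases h : termDeg d (k, α) = s
    · rw [coeff_homComp h, hc]
    · exact coeff_eq_zero_of_mem_gradedPiece (homComp_mem d s f) h
  · rw [Finset.sum_eq_single_of_mem (termDeg d (k, α)), coeff_homComp rfl]
    · refine Finset.mem_image_of_mem _ ?_
      rw [Finsupp.mem_support_iff, termBasis_repr]
      exact hc
    · intro s _ hs
      exact coeff_eq_zero_of_mem_gradedPiece (homComp_mem d s f) (fun h => hs (Eq.symm h))

/-- A graded map sends a term of degree `t` to an element of degree `t`, so it commutes with taking
components. This is what allows preimages and relations to be replaced by homogeneous ones. -/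
theorem linearCombination_homComp {μ : Type} {d : κ → ℤ} {e : μ → ℤ} {v : μ → Free n K κ}
    (hv : ∀ a, v a ∈ gradedPiece d (e a)) (s : ℤ) (P : Free n K μ) :
    Finsupp.linearCombination (Poly n K) v (homComp e s P) =
      homComp d s (Finsupp.linearCombination (Poly n K) v P) := by
  classical
  have key : ((Finsupp.linearCombination (Poly n K) v).restrictScalars K) ∘ₗ homComp e s =
      homComp d s ∘ₗ ((Finsupp.linearCombination (Poly n K) v).restrictScalars K) := by
    refine (termBasis n K μ).ext fun t => ?_
    simp only [LinearMap.comp_apply, LinearMap.restrictScalars_apply, termBasis_apply,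
      homComp_toFree]
    have ht := linearCombination_mem_gradedPiece hv (toFree_mem_gradedPiece (K := K) e t)
    split_ifs with h
    · rw [homComp_of_mem (h ▸ ht)]
    · rw [homComp_of_mem_of_ne ht h, map_zero]
  exact LinearMap.congr_fun key P

/-! ### Units and constant coefficients -/

theorem constantCoeff_ne_zero_of_isUnit {p : Poly n K} (h : IsUnit p) : constantCoeff p ≠ 0 :=
  (h.map constantCoeff).ne_zero

/-- A homogeneous element with an entry that has a nonzero constant coefficient: the entry is
constant. -/
theorem eq_C_of_constantCoeff_ne_zero {d : κ → ℤ} {s : ℤ} {f : Free n K κ}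
    (hf : f ∈ gradedPiece d s) {k : κ} (h : constantCoeff (f k) ≠ 0) :
    f k = C (constantCoeff (f k)) := by
  classical
  have h0 : termDeg d (k, (0 : Fin (n + 1) →₀ ℕ)) = s := hf k 0 h
  ext α
  rw [coeff_C]
  split_ifs with hα
  · rw [← hα, constantCoeff_eq]
  · by_contra hc
    have h1 := hf k α hc
    rw [← h0] at h1
    simp only [termDeg, add_left_inj, Nat.cast_inj, map_zero] at h1
    exact hα ((Finsupp.degree_eq_zero_iff α).1 h1).symm

theorem isUnit_of_constantCoeff_ne_zero {d : κ → ℤ} {s : ℤ} {f : Free n K κ}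
    (hf : f ∈ gradedPiece d s) {k : κ} (h : constantCoeff (f k) ≠ 0) : IsUnit (f k) := by
  rw [eq_C_of_constantCoeff_ne_zero hf h]
  exact (isUnit_iff_ne_zero.2 h).map C

/-- Translates minimality, a condition on units, into the vanishing of constant coefficients, which
is compatible with sums and products. -/
theorem not_isUnit_iff {d : κ → ℤ} {s : ℤ} {f : Free n K κ}
    (hf : f ∈ gradedPiece d s) (k : κ) : ¬ IsUnit (f k) ↔ constantCoeff (f k) = 0 :=
  ⟨fun h => by_contra fun h1 => h (isUnit_of_constantCoeff_ne_zero hf h1),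
    fun h h1 => constantCoeff_ne_zero_of_isUnit h1 h⟩

theorem deg_eq_of_constantCoeff_ne_zero {d : κ → ℤ} {s : ℤ} {f : Free n K κ}
    (hf : f ∈ gradedPiece d s) {k : κ} (h : constantCoeff (f k) ≠ 0) : d k = s := by
  have := hf k 0 h
  simpa [termDeg] using this

theorem linearCombination_entry {μ : Type} [Fintype μ] (v : μ → Free n K κ) (P : Free n K μ)
    (k : κ) : Finsupp.linearCombination (Poly n K) v P k = ∑ a, P a * v a k := by
  rw [Finsupp.linearCombination_apply, Finsupp.sum_fintype _ _ (by simp), Finsupp.finsetSum_apply]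
  rfl

end Terms

/-! ### Reduction by marked families -/

section LexKey

variable {n : ℕ}

/-- Exponent vectors compared lexicographically, the exponents of the largest variable first. -/
def lexKey (δ : Fin (n + 1) →₀ ℕ) : Lex ((Fin (n + 1))ᵒᵈ → ℕ) :=
  toLex fun j => δ (OrderDual.ofDual j)

/-- If `x^ε x^μ` lies in the cone of `x^τ`, which does not divide `x^μ`, then the multiplier of
`x^τ` is lexicographically smaller than `x^ε`. -/
theorem lexKey_lt {ε μ δ τ : Fin (n + 1) →₀ ℕ} (h : ε + μ = δ + τ)
    (hδ : ∀ i, δ i ≠ 0 → IsMultiplicative τ i) (hτ : ¬ τ ≤ μ) : lexKey δ < lexKey ε := by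
  have heq : ∀ i, ε i + μ i = δ i + τ i := fun i => by
    simpa using DFunLike.congr_fun h i
  obtain ⟨i, hi⟩ : ∃ i, μ i < τ i := by
    by_contra! hcon
    exact hτ hcon
  have hi' := heq i
  have hne : (Finset.univ.filter fun j => δ j ≠ ε j).Nonempty :=
    ⟨i, by simp only [Finset.mem_filter, Finset.mem_univ, true_and]; omega⟩
  -- The largest variable in which the two multipliers differ decides the comparison; `i` is one
  -- such variable, so `i ≤ j`.
  set j := (Finset.univ.filter fun j => δ j ≠ ε j).max' hne with hj
  have hjmem : δ j ≠ ε j := by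
    simpa using Finset.max'_mem _ hne
  have hmax : ∀ l, δ l ≠ ε l → l ≤ j := fun l hl => Finset.le_max' _ _ (by simpa using hl)
  have hij : i ≤ j := hmax i (by omega)
  refine ⟨OrderDual.toDual j, fun l hl => ?_, ?_⟩
  · by_contra hc
    exact absurd (hmax (OrderDual.ofDual l) hc) (not_le.2 hl)
  · change δ j < ε j
    rcases hij.eq_or_lt with rfl | hlt
    · omega
    -- Since `x_i` divides `x^τ` and `i < j`, the variable `x_j` is not multiplicative for `x^τ`.
    · have : δ j = 0 := by
        by_contra hc
        exact absurd (hδ j hc i (by simp only [Finsupp.mem_support_iff]; omega)) (not_le.2 hlt)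
      omega

end LexKey

namespace MarkedFamily

variable {n : ℕ} {K : Type*} [Field K]

/-- The degrees of the elements of a family. -/
def idxDeg (D : MarkedFamily n K) (p : D.idx) : ℤ := termDeg D.baseDeg (D.head p)

/-- The union of the cones of the head terms. -/
def cones (D : MarkedFamily n K) : Set (Term n D.base) :=
  {t | ∃ p, t ∈ pommaretCone (D.head p)}

/-- The terms `x^η f_p` with `x^η` a power product of multiplicative variables of the head term of
`f_p`. -/
def multTerms (D : MarkedFamily n K) : Set (Term n D.idx) :=
  {t | ((D.head t.1).1, t.2 + (D.head t.1).2) ∈ pommaretCone (D.head t.1)}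

theorem mem_multTerms {D : MarkedFamily n K} {t : Term n D.idx} :
    t ∈ D.multTerms ↔ ∀ i, t.2 i ≠ 0 → IsMultiplicative (D.head t.1).2 i := by
  constructor
  · rintro ⟨δ, hδ, h⟩
    have : t.2 = δ := by simpa using congrArg Prod.snd h
    rwa [this]
  · intro h
    exact ⟨t.2, h, rfl⟩

/-- A family of homogeneous elements that is a marked basis over the terms generated by its head
terms. -/
structure IsMarked (D : MarkedFamily n K) : Prop where
  finite : Finite D.idx
  homogeneous : ∀ p, D.elt p ∈ gradedPiece D.baseDeg (D.idxDeg p)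
  tail : ∀ p, D.elt p - (D.head p).toFree K ∈ termsIn K D.conesᶜ
  disjoint : ∀ p q t, t ∈ pommaretCone (D.head p) → t ∈ pommaretCone (D.head q) → p = q
  upward : ∀ t ∈ D.cones, ∀ η, (t.1, η + t.2) ∈ D.cones
  span_disjoint : ∀ s g, g ∈ Submodule.span (Poly n K) (Set.range D.elt) →
    g ∈ gradedPiece D.baseDeg s → g ∈ termsIn K D.conesᶜ → g = 0

theorem isWriting_iff {D : MarkedFamily n K} {g : Free n K D.base} {P : Free n K D.idx} :
    D.IsWriting g P ↔ P ∈ termsIn K D.multTerms ∧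
      Finsupp.linearCombination (Poly n K) D.elt P = g := Iff.rfl

namespace IsMarked

variable {D : MarkedFamily n K}

theorem tail_mem (hD : D.IsMarked) (p : D.idx) :
    D.elt p - (D.head p).toFree K ∈
      termsIn K (D.conesᶜ ∩ {t | termDeg D.baseDeg t = D.idxDeg p}) := by
  rw [termsIn_inter]
  exact ⟨hD.tail p, sub_mem (hD.homogeneous p) (toFree_mem_gradedPiece _ _)⟩

/-- A head term cannot divide a term outside the cones, because the cones are closed under
multiplication; so the comparison of exponents above applies. -/
theorem lexKey_lt (hD : D.IsMarked) {p : D.idx} {δ ε : Fin (n + 1) →₀ ℕ} {μ : Term n D.base}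
    (hμ : μ ∉ D.cones) (hδ : (p, δ) ∈ D.multTerms)
    (h : ((μ.1, ε + μ.2) : Term n D.base) = ((D.head p).1, δ + (D.head p).2)) : lexKey δ < lexKey ε := by
  obtain ⟨h1, hsnd⟩ := Prod.mk.inj h
  refine MarkedBases.lexKey_lt hsnd (mem_multTerms.1 hδ) fun hle => hμ ?_
  have h2 := hD.upward (D.head p) ⟨p, mem_pommaretCone_self _⟩ (μ.2 - (D.head p).2)
  rw [tsub_add_cancel_of_le hle, ← h1] at h2
  exact h2

/-- The `K`-subspace spanned by the multiplicative multiples of degree `s`. -/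
def multSpan (D : MarkedFamily n K) (s : ℤ) : Submodule K (Free n K D.base) :=
  (termsIn K (D.multTerms ∩ {t | termDeg D.idxDeg t = s})).map
    ((Finsupp.linearCombination (Poly n K) D.elt).restrictScalars K)

/-- Reduction: `x^δ` times the head of `f_p` is `x^δ f_p` minus `x^δ` times the tail. A tail
multiple falling into a cone has a lexicographically smaller multiplier there, so the process
terminates by well-foundedness of the lexicographic order. -/
theorem toFree_mem_sup_of_mult (hD : D.IsMarked) (s : ℤ) (p : D.idx) (δ : Fin (n + 1) →₀ ℕ)
    (hδ : (p, δ) ∈ D.multTerms)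
    (hs : termDeg D.baseDeg ((D.head p).1, δ + (D.head p).2) = s) :
    Term.toFree K ((D.head p).1, δ + (D.head p).2) ∈
      multSpan D s ⊔ termsIn K (D.conesᶜ ∩ {t | termDeg D.baseDeg t = s}) := by
  generalize hv : lexKey δ = v
  induction v using WellFoundedLT.induction generalizing p δ with
  | ind v ih =>
    subst hv
    have hdeg : (δ.degree : ℤ) + D.idxDeg p = s := by
      rw [← hs, termDeg_add]; rfl
    have h1 : (monomial δ (1 : K)) • D.elt p ∈ multSpan D s := by
      refine ⟨Term.toFree K (p, δ), toFree_mem_termsIn ⟨hδ, hdeg⟩, ?_⟩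
      exact linearCombination_toFree D.elt (p, δ)
    have h2 : (monomial δ (1 : K)) • (D.elt p - (D.head p).toFree K) ∈
        multSpan D s ⊔ termsIn K (D.conesᶜ ∩ {t | termDeg D.baseDeg t = s}) := by
      refine monomial_smul_mem ?_ (hD.tail_mem p)
      rintro μ ⟨hμ, hμdeg⟩
      have hμs : termDeg D.baseDeg (μ.1, δ + μ.2) = s := by
        rw [termDeg_add, ← hdeg, show termDeg D.baseDeg (μ.1, μ.2) = D.idxDeg p from hμdeg]
      by_cases hc : (μ.1, δ + μ.2) ∈ D.cones
      · obtain ⟨q, ε, hε, hq⟩ := hc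
        have hε' : (q, ε) ∈ D.multTerms := mem_multTerms.2 hε
        rw [hq] at hμs ⊢
        exact ih _ (hD.lexKey_lt hμ hε' hq) q ε hε' hμs rfl
      · exact Submodule.mem_sup_right (toFree_mem_termsIn ⟨hc, hμs⟩)
    rw [← monomial_smul_toFree]
    have h3 := sub_mem (Submodule.mem_sup_left h1 :
      _ ∈ multSpan D s ⊔ termsIn K (D.conesᶜ ∩ {t | termDeg D.baseDeg t = s})) h2
    rwa [smul_sub, sub_sub_cancel] at h3

theorem toFree_mem_sup (hD : D.IsMarked) (t : Term n D.base) :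
    t.toFree K ∈ multSpan D (termDeg D.baseDeg t) ⊔
      termsIn K (D.conesᶜ ∩ {u | termDeg D.baseDeg u = termDeg D.baseDeg t}) := by
  by_cases hc : t ∈ D.cones
  · obtain ⟨q, ε, hε, rfl⟩ := hc
    exact hD.toFree_mem_sup_of_mult _ q ε (mem_multTerms.2 hε) rfl
  · exact Submodule.mem_sup_right (toFree_mem_termsIn ⟨hc, rfl⟩)

theorem gradedPiece_le_sup (hD : D.IsMarked) (s : ℤ) :
    gradedPiece D.baseDeg s ≤
      multSpan D s ⊔ termsIn K (D.conesᶜ ∩ {u | termDeg D.baseDeg u = s}) := by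
  rw [gradedPiece_eq_termsIn, termsIn_le_iff]
  rintro t rfl
  exact hD.toFree_mem_sup t

theorem linearCombination_mem_span (D : MarkedFamily n K) (P : Free n K D.idx) :
    Finsupp.linearCombination (Poly n K) D.elt P ∈
      Submodule.span (Poly n K) (Set.range D.elt) := by
  rw [← Finsupp.range_linearCombination]
  exact LinearMap.mem_range_self _ P

/-- Homogeneous elements of the module generated by a marked family have homogeneous writings. -/
theorem exists_isWriting (hD : D.IsMarked) {s : ℤ} {g : Free n K D.base}
    (hg : g ∈ Submodule.span (Poly n K) (Set.range D.elt)) (hs : g ∈ gradedPiece D.baseDeg s) :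
    ∃ P, D.IsWriting g P ∧ P ∈ gradedPiece D.idxDeg s := by
  obtain ⟨_, ⟨P, hP, rfl⟩, ν, hν, h⟩ := Submodule.mem_sup.1 (hD.gradedPiece_le_sup s hs)
  rw [SetLike.mem_coe, termsIn_inter] at hP
  rw [termsIn_inter] at hν
  refine ⟨P, ⟨hP.1, ?_⟩, hP.2⟩
  -- The irreducible remainder is the difference of two elements of the generated module, and it has
  -- no term in the cones.
  have hν0 : ν = 0 := by
    refine hD.span_disjoint s ν ?_ hν.2 hν.1
    rw [← eq_sub_iff_add_eq'] at h
    rw [h]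
    exact sub_mem hg (linearCombination_mem_span D P)
  rw [hν0, add_zero] at h
  exact h

/-- Uniqueness of writings. -/
theorem eq_zero_of_mult (hD : D.IsMarked) {P : Free n K D.idx} (hP : P ∈ termsIn K D.multTerms)
    (h : Finsupp.linearCombination (Poly n K) D.elt P = 0) : P = 0 := by
  classical
  by_contra hne
  set b := termBasis n K D.idx with hb
  have hsupp : (b.repr P).support.Nonempty := by
    rw [Finsupp.support_nonempty_iff]
    exact fun h0 => hne (b.repr.map_eq_zero_iff.1 h0)
  -- The head multiple `u` belonging to a maximal multiplier `t₀` cannot cancel: by disjointness of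
  -- the cones no other head multiple equals `u`, and if `u` came from a tail, the multiplier there
  -- would exceed `t₀`.
  obtain ⟨t₀, ht₀, hmax⟩ := Finset.exists_max_image _ (fun t : Term n D.idx => lexKey t.2) hsupp
  have hmem : ∀ t ∈ (b.repr P).support, t ∈ D.multTerms := by
    intro t ht
    rw [Finsupp.mem_support_iff, termBasis_repr] at ht
    exact hP t.1 t.2 ht
  set u : Term n D.base := ((D.head t₀.1).1, t₀.2 + (D.head t₀.1).2) with hu
  have hcoeff : ∀ t ∈ (b.repr P).support,
      (((monomial t.2 (1 : K)) • D.elt t.1) u.1).coeff u.2 = if t = t₀ then 1 else 0 := by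
    intro t ht
    have htail : (((monomial t.2 (1 : K)) • (D.elt t.1 - (D.head t.1).toFree K)) u.1).coeff u.2
        = 0 := by
      refine coeff_eq_zero_of_mem_termsIn (A := {v | ∃ μ ∉ D.cones, v = (μ.1, t.2 + μ.2)})
        (monomial_smul_mem_termsIn (A := D.conesᶜ) (η := t.2)
          (B := {v | ∃ μ ∉ D.cones, v = (μ.1, t.2 + μ.2)}) (fun μ hμ => ⟨μ, hμ, rfl⟩)
          (hD.tail t.1)) ?_
      rintro ⟨μ, hμ, hμu⟩
      exact absurd (hmax t ht) (not_le.2 (hD.lexKey_lt hμ (hmem t₀ ht₀) hμu.symm))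
    rw [smul_sub, Finsupp.sub_apply, coeff_sub, sub_eq_zero] at htail
    rw [htail, monomial_smul_toFree]
    split_ifs with heq
    · subst heq
      exact coeff_toFree_self u
    · refine coeff_toFree_of_ne fun hh => heq ?_
      have h1 : t.1 = t₀.1 := hD.disjoint _ _ u
        (by rw [show u = _ from hh.symm]; exact hmem t ht) (hmem t₀ ht₀)
      refine Prod.ext h1 ?_
      have h2 : t.2 + (D.head t.1).2 = t₀.2 + (D.head t₀.1).2 := congrArg Prod.snd hh
      rwa [h1, add_left_inj] at h2
  have hsum : (Finsupp.linearCombination (Poly n K) D.elt P u.1).coeff u.2 = b.repr P t₀ := by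
    conv_lhs => rw [← b.linearCombination_repr P, Finsupp.linearCombination_apply K, Finsupp.sum,
      map_sum, Finsupp.finsetSum_apply, MvPolynomial.coeff_sum]
    rw [Finset.sum_eq_single_of_mem t₀ ht₀]
    · rw [termBasis_apply, LinearMap.map_smul_of_tower, linearCombination_toFree,
        Finsupp.smul_apply, coeff_smul, hcoeff t₀ ht₀, if_pos rfl, smul_eq_mul, mul_one]
    · intro t ht htne
      rw [termBasis_apply, LinearMap.map_smul_of_tower, linearCombination_toFree,
        Finsupp.smul_apply, coeff_smul, hcoeff t ht, if_neg htne, smul_zero]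
  rw [h] at hsum
  exact Finsupp.mem_support_iff.1 ht₀ (by rw [← hsum]; simp)

theorem isWriting_unique (hD : D.IsMarked) {g : Free n K D.base} {P Q : Free n K D.idx}
    (hP : D.IsWriting g P) (hQ : D.IsWriting g Q) : P = Q := by
  rw [isWriting_iff] at hP hQ
  refine sub_eq_zero.1 (hD.eq_zero_of_mult (sub_mem hP.1 hQ.1) ?_)
  rw [map_sub, hP.2, hQ.2, sub_self]

/-! ### The fundamental syzygies form a marked family -/

theorem X_smul_elt_mem (hD : D.IsMarked) (i : Fin (n + 1)) (p : D.idx) :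
    (X i : Poly n K) • D.elt p ∈ gradedPiece D.baseDeg (1 + D.idxDeg p) := by
  have := monomial_smul_mem_gradedPiece (hD.homogeneous p) (Finsupp.single i 1)
  simpa [X] using this

/-- The chosen writing is homogeneous because it coincides, by uniqueness, with the homogeneous one
produced by reduction. -/
theorem writing_spec (hD : D.IsMarked) (i : Fin (n + 1)) (p : D.idx) :
    D.IsWriting ((X i : Poly n K) • D.elt p) (D.writing ((X i : Poly n K) • D.elt p)) ∧
      D.writing ((X i : Poly n K) • D.elt p) ∈ gradedPiece D.idxDeg (1 + D.idxDeg p) := by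
  obtain ⟨P, hP, hdeg⟩ := hD.exists_isWriting
    (Submodule.smul_mem _ _ (Submodule.subset_span ⟨p, rfl⟩)) (hD.X_smul_elt_mem i p)
  have hex : ∃ P, D.IsWriting ((X i : Poly n K) • D.elt p) P := ⟨P, hP⟩
  have h1 : D.IsWriting ((X i : Poly n K) • D.elt p) (D.writing ((X i : Poly n K) • D.elt p)) := by
    unfold writing
    rw [dif_pos hex]
    exact hex.choose_spec
  exact ⟨h1, hD.isWriting_unique hP h1 ▸ hdeg⟩

/-- The fundamental syzygies as elements of the free module on the symbols `f_p`. -/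
def syzElt (D : MarkedFamily n K) : D.syzygies.idx → Free n K D.idx := D.syzygies.elt

/-- The terms generated by the head terms of the fundamental syzygies. -/
def syzCones (D : MarkedFamily n K) : Set (Term n D.idx) := D.syzygies.cones

/-- The irreducible terms for the syzygies are exactly the terms allowed in writings. Uniqueness of
writings therefore becomes the directness condition one step further. -/
theorem syzCones_eq (D : MarkedFamily n K) : syzCones D = D.multTermsᶜ := by
  ext t
  rw [Set.mem_compl_iff, mem_multTerms]
  constructor
  · rintro ⟨⟨⟨i, p⟩, hi⟩, δ, hδ, rfl⟩ hcon
    exact hi (hcon i (by change ((δ + Finsupp.single i 1 : Fin (n + 1) →₀ ℕ) i) ≠ 0; simp))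
  · intro h
    push Not at h
    obtain ⟨i, hi, hmult⟩ := h
    have hne : t.2.support.Nonempty := ⟨i, Finsupp.mem_support_iff.2 hi⟩
    -- Splitting off the largest variable leaves a cofactor in variables `≤ x_l`, all multiplicative
    -- for `x_l`; and `x_l` is itself non-multiplicative for the head of `f_p`, as it is at least
    -- `x_i`.
    set l := t.2.support.max' hne with hl
    have hlmem : t.2 l ≠ 0 := Finsupp.mem_support_iff.1 (Finset.max'_mem _ hne)
    have hil : i ≤ l := Finset.le_max' _ _ (Finsupp.mem_support_iff.2 hi)
    have hlm : ¬ IsMultiplicative (D.head t.1).2 l := fun hc =>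
      hmult fun j hj => hil.trans (hc j hj)
    refine ⟨⟨(l, t.1), hlm⟩, t.2 - Finsupp.single l 1, ?_, ?_⟩
    · intro j hj j' hj'
      have hj'l : j' = l := by
        by_contra hc
        rw [Finsupp.mem_support_iff] at hj'
        exact hj' (Finsupp.single_eq_of_ne hc)
      rw [hj'l]
      refine Finset.le_max' _ _ (Finsupp.mem_support_iff.2 fun h0 => hj ?_)
      simp [h0]
    · refine Prod.ext rfl ?_
      change t.2 = t.2 - Finsupp.single l 1 + Finsupp.single l 1
      rw [tsub_add_cancel_of_le]
      rw [Finsupp.single_le_iff]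
      omega

theorem X_single_eq (p : D.idx) (i : Fin (n + 1)) :
    Finsupp.single p (X i : Poly n K) = Term.toFree K (p, Finsupp.single i 1) := rfl

theorem span_syzygies_le_ker (hD : D.IsMarked) :
    Submodule.span (Poly n K) (Set.range (syzElt D)) ≤
      LinearMap.ker (Finsupp.linearCombination (Poly n K) D.elt) := by
  rw [Submodule.span_le]
  rintro _ ⟨⟨⟨i, p⟩, hi⟩, rfl⟩
  rw [SetLike.mem_coe, LinearMap.mem_ker]
  change Finsupp.linearCombination (Poly n K) D.elt (D.fundamentalSyzygy i p) = 0
  rw [fundamentalSyzygy, map_sub, Finsupp.linearCombination_single,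
    (isWriting_iff.1 (hD.writing_spec i p).1).2, sub_self]

/-- The tail of a syzygy is minus a writing, hence lies outside the cones. An element of the span
that is irreducible is both a relation and a writing of zero, so it vanishes. -/
theorem syzygies (hD : D.IsMarked) : D.syzygies.IsMarked where
  finite := by
    have := hD.finite
    unfold MarkedFamily.syzygies
    infer_instance
  homogeneous := by
    rintro ⟨⟨i, p⟩, hi⟩
    have h1 := toFree_mem_gradedPiece (K := K) D.idxDeg (p, Finsupp.single i 1)
    have h2 := (hD.writing_spec i p).2
    have h3 : termDeg D.idxDeg (p, Finsupp.single i 1) = 1 + D.idxDeg p := by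
      simp [termDeg]
    rw [← h3] at h2
    exact sub_mem h1 h2
  tail := by
    rintro ⟨⟨i, p⟩, hi⟩
    change Finsupp.single p (X i : Poly n K) - D.writing ((X i : Poly n K) • D.elt p) -
      Term.toFree K (p, Finsupp.single i 1) ∈ termsIn K (syzCones D)ᶜ
    rw [syzCones_eq, compl_compl, X_single_eq, sub_sub_cancel_left]
    exact neg_mem (isWriting_iff.1 (hD.writing_spec i p).1).1
  disjoint := by
    -- In a product from the cone of `x_j` every variable is `≤ x_j`; applied in both directions,
    -- the largest variable determines the head term.
    have key : ∀ (i j : Fin (n + 1)) (δ ε : Fin (n + 1) →₀ ℕ),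
        (∀ l, δ l ≠ 0 → IsMultiplicative (Finsupp.single i 1) l) →
        (∀ l, ε l ≠ 0 → IsMultiplicative (Finsupp.single j 1) l) →
        δ + Finsupp.single i 1 = ε + Finsupp.single j 1 → i ≤ j := by
      intro i j δ ε _ hε h
      by_cases h0 : ε i = 0
      · have h1 := DFunLike.congr_fun h i
        rw [Finsupp.add_apply, Finsupp.add_apply, h0, Finsupp.single_eq_same] at h1
        by_contra hc
        rw [Finsupp.single_eq_of_ne (fun hh : i = j => hc hh.le)] at h1
        omega
      · exact hε i h0 j (by simp)
    rintro ⟨⟨i, p⟩, hi⟩ ⟨⟨j, q⟩, hj⟩ _ ⟨δ, hδ, rfl⟩ ⟨ε, hε, h⟩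
    have h1 : p = q := congrArg Prod.fst h
    have h2 : δ + Finsupp.single i 1 = ε + Finsupp.single j 1 := congrArg Prod.snd h
    subst h1
    have h3 : i = j := le_antisymm (key i j δ ε hδ hε h2) (key j i ε δ hε hδ h2.symm)
    subst h3
    rfl
  upward := by
    intro (t : Term n D.idx) (ht : t ∈ syzCones D) η
    change (t.1, η + t.2) ∈ syzCones D
    rw [syzCones_eq, Set.mem_compl_iff, mem_multTerms] at ht ⊢
    refine fun hc => ht fun i hi => hc i ?_
    rw [Finsupp.add_apply]
    omega
  span_disjoint := by
    intro s (g : Free n K D.idx) hg _ (hN : g ∈ termsIn K (syzCones D)ᶜ)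
    rw [syzCones_eq, compl_compl] at hN
    exact hD.eq_zero_of_mult hN (hD.span_syzygies_le_ker hg)

/-- The fundamental syzygies generate the module of syzygies. -/
theorem range_syzygies (hD : D.IsMarked) :
    LinearMap.range (Finsupp.linearCombination (Poly n K) (syzElt D)) =
      LinearMap.ker (Finsupp.linearCombination (Poly n K) D.elt) := by
  apply le_antisymm
  · rw [Finsupp.range_linearCombination]
    exact hD.span_syzygies_le_ker
  · intro h hh
    -- Every element is a combination of syzygies plus an element of multiplicative terms. For a
    -- relation the latter part is a writing of zero.
    have key : termsIn K (Set.univ : Set (Term n D.idx)) ≤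
        (LinearMap.range (Finsupp.linearCombination (Poly n K) (syzElt D))).restrictScalars K ⊔
          termsIn K D.multTerms := by
      rw [termsIn_le_iff]
      intro t _
      obtain ⟨W, hW, ht⟩ : ∃ W : Submodule K (Free n K D.idx),
          W ≤ (LinearMap.range (Finsupp.linearCombination (Poly n K)
            (syzElt D))).restrictScalars K ∧
          t.toFree K ∈ W ⊔
            termsIn K ((syzCones D)ᶜ ∩ {u | termDeg D.idxDeg u = termDeg D.idxDeg t}) := by
        refine ⟨multSpan D.syzygies (termDeg D.idxDeg t), ?_, hD.syzygies.toFree_mem_sup t⟩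
        rintro _ ⟨P, -, rfl⟩
        exact LinearMap.mem_range_self (Finsupp.linearCombination (Poly n K) (syzElt D)) P
      rw [syzCones_eq, compl_compl] at ht
      exact sup_le_sup hW (termsIn_mono Set.inter_subset_left) ht
    have hmem : h ∈ termsIn K (Set.univ : Set (Term n D.idx)) := by
      rw [termsIn_univ]; exact Submodule.mem_top
    obtain ⟨w, hw, ν, hν, rfl⟩ := Submodule.mem_sup.1 (key hmem)
    have hw' : w ∈ LinearMap.range (Finsupp.linearCombination (Poly n K) (syzElt D)) := hw
    have hwk := hw'
    rw [Finsupp.range_linearCombination] at hwk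
    have h1 := hD.span_syzygies_le_ker hwk
    rw [LinearMap.mem_ker] at h1 hh
    rw [map_add, h1, zero_add] at hh
    rw [hD.eq_zero_of_mult hν hh, add_zero]
    exact hw'

theorem iterSyzygies (hD : D.IsMarked) (t : ℕ) : (D.iterSyzygies t).IsMarked := by
  induction t with
  | zero => exact hD
  | succ t ih => exact ih.syzygies

/-- The sequence of iterated fundamental syzygies is a graded free resolution. -/
theorem isResolution (hD : D.IsMarked) :
    D.resolution.IsResolution D.baseDeg (Submodule.span (Poly n K) (Set.range D.elt)) where
  finite t := (hD.iterSyzygies t).finite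
  aug_homogeneous p := hD.homogeneous p
  diff_homogeneous t p := (hD.iterSyzygies (t + 1)).homogeneous p
  range_aug := Finsupp.range_linearCombination _
  exact_zero := hD.range_syzygies
  exact_succ t := (hD.iterSyzygies (t + 1)).range_syzygies

/-! ### Constant coefficients of iterated syzygies -/

/-- The product rule for linear parts; the other summand drops out because `q` has no constant term.
-/
theorem coeff_single_one_mul (p q : Poly n K) (hq : constantCoeff q = 0) (l : Fin (n + 1)) :
    (p * q).coeff (Finsupp.single l 1) = constantCoeff p * q.coeff (Finsupp.single l 1) := by
  classical
  rw [coeff_mul, Finsupp.antidiagonal_single]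
  simp only [Finset.sum_map, Finset.Nat.antidiagonal_succ, Finset.Nat.antidiagonal_zero,
    Finset.sum_cons, Finset.map_singleton, Finset.sum_singleton]
  rw [constantCoeff_eq] at hq ⊢
  simp [hq]

-- The coefficients at the head terms form a dual system to the fundamental syzygies: all tails
-- consist of multiplicative terms, while a head `x_i f_σ` has `x_i` non-multiplicative.
open Classical in
theorem coeff_syzElt (hD : D.IsMarked) (a b : D.syzygies.idx) :
    (syzElt D a b.1.2).coeff (Finsupp.single b.1.1 1) = if a = b then 1 else 0 := by
  have htail : syzElt D a - Term.toFree K (a.1.2, Finsupp.single a.1.1 1) ∈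
      termsIn K (syzCones D)ᶜ := hD.syzygies.tail a
  rw [syzCones_eq, compl_compl] at htail
  have h0 := coeff_eq_zero_of_mem_termsIn htail (k := b.1.2) (α := Finsupp.single b.1.1 1)
    (fun h => b.2 (mem_multTerms.1 h b.1.1 (by simp)))
  rw [Finsupp.sub_apply, coeff_sub, sub_eq_zero] at h0
  rw [h0]
  split_ifs with hab
  · subst hab
    exact coeff_toFree_self (K := K) (a.1.2, Finsupp.single a.1.1 1)
  · refine coeff_toFree_of_ne fun h => hab ?_
    obtain ⟨h1, h2⟩ := Prod.mk.inj h
    exact Subtype.ext (Prod.ext (Finsupp.single_left_injective one_ne_zero h2) h1)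

/-- If no entry of the fundamental syzygies has a constant coefficient, then the same holds for the
fundamental syzygies of the fundamental syzygies. -/
theorem constantCoeff_syzygies_syzygies (hD : D.IsMarked)
    (h : ∀ a b, constantCoeff (D.syzygies.elt a b) = 0) :
    ∀ a b, constantCoeff (D.syzygies.syzygies.elt a b) = 0 := by
  classical
  rintro ⟨⟨j, q⟩, hj⟩ (b : D.syzygies.idx)
  have hfin := hD.syzygies.finite
  have := Fintype.ofFinite D.syzygies.idx
  obtain ⟨P, hPdef⟩ : ∃ P, P = D.syzygies.writing ((X j : Poly n K) • D.syzygies.elt q) :=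
    ⟨_, rfl⟩
  have hP : Finsupp.linearCombination (Poly n K) (syzElt D) P = (X j : Poly n K) • syzElt D q := by
    rw [hPdef]
    exact (isWriting_iff.1 (hD.syzygies.writing_spec j q).1).2
  change constantCoeff ((Finsupp.single q (X j : Poly n K) -
    D.syzygies.writing ((X j : Poly n K) • D.syzygies.elt q)) b) = 0
  rw [← hPdef, Finsupp.sub_apply, map_sub]
  have h1 : constantCoeff (Finsupp.single q (X j : Poly n K) b) = 0 := by
    rw [Finsupp.single_apply]
    split_ifs <;> simp
  rw [h1, zero_sub, neg_eq_zero]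
  -- Compare coefficients at the head term of `b`: the sum collapses to the constant coefficient of
  -- `P b`, and the factor `X j` makes the other side vanish.
  have h2 := congrArg (fun f : Free n K D.idx => (f b.1.2).coeff (Finsupp.single b.1.1 1)) hP
  simp only [linearCombination_entry, Finsupp.smul_apply, smul_eq_mul, coeff_sum] at h2
  have hc : ∀ p, constantCoeff (syzElt D p b.1.2) = 0 := fun p => h p b.1.2
  rw [coeff_single_one_mul _ _ (hc q), constantCoeff_X, zero_mul,
    Finset.sum_congr rfl fun p _ => coeff_single_one_mul (P p) _ (hc p) b.1.1] at h2
  simpa [hD.coeff_syzElt] using h2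

theorem constantCoeff_iterSyzygies (hD : D.IsMarked) {k : ℕ}
    (h : ∀ a b, constantCoeff ((D.iterSyzygies (k + 1)).elt a b) = 0) {i : ℕ} (hi : k ≤ i) :
    ∀ a b, constantCoeff ((D.iterSyzygies (i + 1)).elt a b) = 0 := by
  induction i, hi using Nat.le_induction with
  | base => exact h
  | succ i _ ih => exact (hD.iterSyzygies i).constantCoeff_syzygies_syzygies ih

end IsMarked

end MarkedFamily

/-! ### The ranks of the resolution by iterated syzygies -/

section Ranks

variable {n : ℕ} {K : Type*} [Field K]

theorem isMultiplicative_iff_le_minIndex {α : Fin (n + 1) →₀ ℕ} {i : Fin (n + 1)} :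
    IsMultiplicative α i ↔ i ≤ minIndex α := by
  unfold minIndex
  split_ifs with h
  · exact (Finset.le_min'_iff _ h).symm
  · rw [Finset.not_nonempty_iff_eq_empty] at h
    simp [IsMultiplicative, h, Fin.le_last]

theorem minIndex_single (i : Fin (n + 1)) : minIndex (Finsupp.single i 1) = i := by
  refine le_antisymm ?_ ?_
  · exact isMultiplicative_iff_le_minIndex.2 le_rfl i (by simp)
  · rw [← isMultiplicative_iff_le_minIndex]
    intro j hj
    by_contra hc
    exact Finsupp.mem_support_iff.1 hj (Finsupp.single_eq_of_ne fun h => hc h.ge)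

/-- The hockey-stick identity after the reflection `i ↦ n - i`. -/
theorem sum_choose_of_lt (q : Fin (n + 1)) (t : ℕ) :
    ∑ i : Fin (n + 1), (if q < i then (n - (i : ℕ)).choose t else 0) =
      (n - (q : ℕ)).choose (t + 1) := by
  have hq := q.2
  calc ∑ i : Fin (n + 1), (if q < i then (n - (i : ℕ)).choose t else 0)
      = ∑ i ∈ Finset.range (n + 1), (if (q : ℕ) < i then (n - i).choose t else 0) :=
        Fin.sum_univ_eq_sum_range (fun i => if (q : ℕ) < i then (n - i).choose t else 0) (n + 1)
    _ = ∑ i ∈ Finset.range (n + 1), (if i < n - (q : ℕ) then i.choose t else 0) := by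
        rw [← Finset.sum_range_reflect]
        refine Finset.sum_congr rfl fun i hi => ?_
        have hi' := Finset.mem_range.1 hi
        rw [show n - (n + 1 - 1 - i) = i by omega]
        exact if_congr (by omega) rfl rfl
    _ = ∑ i ∈ Finset.range (n - (q : ℕ)), i.choose t := by
        rw [← Finset.sum_filter]
        refine Finset.sum_congr ?_ fun _ _ => rfl
        ext i
        simp only [Finset.mem_filter, Finset.mem_range]
        omega
    _ = (n - (q : ℕ)).choose (t + 1) := by
        generalize n - (q : ℕ) = N
        induction N with
        | zero => simp
        | succ N ih => rw [Finset.sum_range_succ, ih, Nat.choose_succ_succ, add_comm]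

namespace MarkedFamily

/-- Peels off the innermost step instead of the outermost, so that ranks can be computed by
induction over all families. -/
theorem iterSyzygies_succ' (D : MarkedFamily n K) (t : ℕ) :
    D.iterSyzygies (t + 1) = D.syzygies.iterSyzygies t := by
  induction t with
  | zero => rfl
  | succ t ih =>
    change (D.iterSyzygies (t + 1)).syzygies = (D.syzygies.iterSyzygies t).syzygies
    rw [ih]

/-- An element of degree `h` with minimal variable `x_q` has one syzygy for each `i > q`, of degree
`h + 1` and with minimal variable `x_i`. Summing the binomials for these `i` raises the lower index
by one. -/
theorem card_iterSyzygies (t : ℕ) (D : MarkedFamily n K) [Fintype D.idx] (j : ℤ) :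
    Nat.card {a : (D.iterSyzygies t).idx // (D.iterSyzygies t).idxDeg a = j} =
      ∑ p : D.idx, if D.idxDeg p = j - t then
        (n - (minIndex (D.head p).2 : ℕ)).choose t else 0 := by
  classical
  induction t generalizing D with
  | zero =>
    change Nat.card {a : D.idx // D.idxDeg a = j} = _
    rw [Nat.card_eq_fintype_card, Fintype.card_subtype, Finset.card_filter]
    simp
  | succ t ih =>
    rw [iterSyzygies_succ']
    have hfin : Fintype D.syzygies.idx :=
      inferInstanceAs (Fintype {q : Fin (n + 1) × D.idx // ¬ IsMultiplicative (D.head q.2).2 q.1})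
    rw [ih D.syzygies]
    have h1 : ∀ a : D.syzygies.idx,
        (if D.syzygies.idxDeg a = j - t then
          (n - (minIndex (D.syzygies.head a).2 : ℕ)).choose t else 0) =
        (if D.idxDeg a.1.2 = j - (t + 1 : ℕ) then (n - (a.1.1 : ℕ)).choose t else 0) := by
      intro a
      have hdeg : D.syzygies.idxDeg a = 1 + D.idxDeg a.1.2 := by
        change termDeg D.idxDeg (a.1.2, Finsupp.single a.1.1 1) = _
        simp [termDeg]
      have hmin : minIndex (D.syzygies.head a).2 = a.1.1 := minIndex_single a.1.1
      rw [hmin, hdeg]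
      refine if_congr ?_ rfl rfl
      push_cast
      constructor <;> intro h <;> linarith
    rw [Finset.sum_congr rfl fun a _ => h1 a]
    have h2 : ∑ a : D.syzygies.idx, (if D.idxDeg a.1.2 = j - (t + 1 : ℕ) then
          (n - (a.1.1 : ℕ)).choose t else 0) =
        ∑ q : Fin (n + 1) × D.idx, if ¬ IsMultiplicative (D.head q.2).2 q.1 then
          (if D.idxDeg q.2 = j - (t + 1 : ℕ) then (n - (q.1 : ℕ)).choose t else 0) else 0 := by
      exact (Finset.sum_subtype (Finset.univ.filter fun q : Fin (n + 1) × D.idx =>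
        ¬ IsMultiplicative (D.head q.2).2 q.1) (p := fun q : Fin (n + 1) × D.idx =>
        ¬ IsMultiplicative (D.head q.2).2 q.1) (by simp) (fun q => if D.idxDeg q.2 =
          j - (t + 1 : ℕ) then (n - (q.1 : ℕ)).choose t else 0)).symm.trans (Finset.sum_filter _ _)
    rw [h2, Fintype.sum_prod_type_right]
    refine Finset.sum_congr rfl fun p _ => ?_
    simp only [isMultiplicative_iff_le_minIndex, not_le]
    split_ifs with h
    · exact sum_choose_of_lt _ t
    · simp

end MarkedFamily

end Ranks

/-! ### Comparison of graded free resolutions -/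

variable {n : ℕ} {K : Type*} [Field K] {ι : Type}

section Lifting

variable {κ μ ν ρ : Type}

local notation "lc" => Finsupp.linearCombination (Poly n K)

/-- A homogeneous element in the image of a graded map has a homogeneous preimage. -/
theorem exists_graded_preimage {d : κ → ℤ} {e : μ → ℤ} {v : μ → Free n K κ}
    (hv : ∀ a, v a ∈ gradedPiece d (e a)) {s : ℤ} {z : Free n K κ}
    (hz : z ∈ LinearMap.range (lc v)) (hs : z ∈ gradedPiece d s) :
    ∃ y ∈ gradedPiece e s, lc v y = z := by
  obtain ⟨y, rfl⟩ := hz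
  exact ⟨homComp e s y, homComp_mem e s y, by
    rw [linearCombination_homComp hv, homComp_of_mem hs]⟩

theorem linearCombination_comp (v : μ → Free n K κ) (w : ν → Free n K μ) (x : Free n K ν) :
    lc (fun a => lc v (w a)) x = lc v (lc w x) := by
  have := Finsupp.linearCombination_linear_comp (Poly n K) (v := w) (lc v)
  exact LinearMap.congr_fun this x

theorem linearCombination_single_one (x : Free n K κ) :
    lc (fun a : κ => (Finsupp.single a 1 : Free n K κ)) x = x := by
  rw [Finsupp.linearCombination_apply]
  simp

theorem linearCombination_sub_fun (v w : μ → Free n K κ) (x : Free n K μ) :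
    lc (fun a => v a - w a) x = lc v x - lc w x := by
  simp [Finsupp.linearCombination_apply, Finsupp.sum, smul_sub, Finset.sum_sub_distrib]

/-- The matrix of constant coefficients of a map of free modules. -/
def constMatrix (v : μ → Free n K κ) : Matrix κ μ K :=
  Matrix.of fun b a => constantCoeff (v a b)

/-- Taking constant coefficients is a ring homomorphism, so reduction modulo the variables is
functorial. -/
theorem constMatrix_comp [Fintype μ] (v : μ → Free n K κ) (w : ν → Free n K μ) :
    constMatrix (fun a => lc v (w a)) = constMatrix v * constMatrix w := by
  ext b a
  simp only [constMatrix, Matrix.of_apply, Matrix.mul_apply, linearCombination_entry, map_sum,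
    map_mul]
  exact Finset.sum_congr rfl fun _ _ => mul_comm _ _

theorem constMatrix_single [DecidableEq κ] :
    constMatrix (fun a : κ => (Finsupp.single a 1 : Free n K κ)) = 1 := by
  ext b a
  simp only [constMatrix, Matrix.of_apply, Matrix.one_apply, Finsupp.single_apply]
  rw [apply_ite constantCoeff, map_one, map_zero]
  exact if_congr eq_comm rfl rfl

end Lifting

/-- The maps of a sequence of graded free modules, the augmentation included. -/
structure AugSequence (n : ℕ) (K : Type*) [Field K] where
  idx : ℕ → Type
  deg : ∀ i, idx i → ℤ
  diff : ∀ i, idx (i + 1) → Free n K (idx i)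

namespace AugSequence

variable (C C' : AugSequence n K)

local notation "lc" => Finsupp.linearCombination (Poly n K)

/-- Homogeneous maps with exactness at all places but the last. -/
structure IsExact : Prop where
  homogeneous : ∀ i a, C.diff i a ∈ gradedPiece (C.deg i) (C.deg (i + 1) a)
  exact : ∀ i, LinearMap.range (lc (C.diff (i + 1))) = LinearMap.ker (lc (C.diff i))

/-- A graded map in position `i` that maps the image of the incoming differential to the image of
the incoming differential. -/
structure IsLift (i : ℕ) (φ : C.idx i → Free n K (C'.idx i)) : Prop where
  homogeneous : ∀ a, φ a ∈ gradedPiece (C'.deg i) (C.deg i a)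
  map_range : ∀ x, lc φ (lc (C.diff i) x) ∈ LinearMap.range (lc (C'.diff i))

variable {C C'}

theorem IsExact.diff_diff (hC : C.IsExact) (i : ℕ) (x : Free n K (C.idx (i + 2))) :
    lc (C.diff i) (lc (C.diff (i + 1)) x) = 0 := by
  have : lc (C.diff (i + 1)) x ∈ LinearMap.range (lc (C.diff (i + 1))) :=
    LinearMap.mem_range_self _ x
  rw [hC.exact i] at this
  exact this

/-- The image of a basis element is a homogeneous boundary, so it has a homogeneous preimage. The
image condition for the next step follows from exactness. -/
theorem exists_lift_succ (hC : C.IsExact) (hC' : C'.IsExact) {i : ℕ}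
    {φ : C.idx i → Free n K (C'.idx i)} (hφ : IsLift C C' i φ) :
    ∃ ψ : C.idx (i + 1) → Free n K (C'.idx (i + 1)), IsLift C C' (i + 1) ψ ∧
      ∀ x, lc (C'.diff i) (lc ψ x) = lc φ (lc (C.diff i) x) := by
  have h1 : ∀ a : C.idx (i + 1), ∃ y ∈ gradedPiece (C'.deg (i + 1)) (C.deg (i + 1) a),
      lc (C'.diff i) y = lc φ (C.diff i a) := by
    intro a
    refine exists_graded_preimage (hC'.homogeneous i) ?_
      (linearCombination_mem_gradedPiece hφ.homogeneous (hC.homogeneous i a))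
    have := hφ.map_range (Finsupp.single a 1)
    rwa [Finsupp.linearCombination_single, one_smul] at this
  choose ψ hψ1 hψ2 using h1
  have hcomm : ∀ x, lc (C'.diff i) (lc ψ x) = lc φ (lc (C.diff i) x) := by
    intro x
    rw [← linearCombination_comp, ← linearCombination_comp]
    simp only [hψ2]
  refine ⟨ψ, ⟨hψ1, fun x => ?_⟩, hcomm⟩
  rw [hC'.exact i, LinearMap.mem_ker, hcomm, hC.diff_diff, map_zero]

/-- A graded map in position zero that is compatible with the images extends to a graded map of
sequences. -/
theorem exists_lift (hC : C.IsExact) (hC' : C'.IsExact) {φ₀ : C.idx 0 → Free n K (C'.idx 0)}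
    (h₀ : IsLift C C' 0 φ₀) :
    ∃ φ : ∀ i, C.idx i → Free n K (C'.idx i), φ 0 = φ₀ ∧
      (∀ i a, φ i a ∈ gradedPiece (C'.deg i) (C.deg i a)) ∧
      ∀ i x, lc (C'.diff i) (lc (φ (i + 1)) x) = lc (φ i) (lc (C.diff i) x) := by
  choose next hnext1 hnext2 using
    fun (i : ℕ) (φ : {φ : C.idx i → Free n K (C'.idx i) // IsLift C C' i φ}) =>
      exists_lift_succ hC hC' φ.2
  let Φ : ∀ i, {φ : C.idx i → Free n K (C'.idx i) // IsLift C C' i φ} := fun i =>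
    Nat.rec ⟨φ₀, h₀⟩ (fun i φ => ⟨next i φ, hnext1 i φ⟩) i
  exact ⟨fun i => (Φ i).1, rfl, fun i => (Φ i).2.homogeneous, fun i => hnext2 i (Φ i)⟩

/-- An endomorphism of an exact sequence that vanishes in position zero is homotopic to zero. -/
theorem exists_homotopy (hC : C.IsExact) (α : ∀ i, C.idx i → Free n K (C.idx i))
    (hα₀ : ∀ x, lc (α 0) x = 0)
    (hα : ∀ i x, lc (C.diff i) (lc (α (i + 1)) x) = lc (α i) (lc (C.diff i) x)) :
    ∃ h : ∀ i, C.idx i → Free n K (C.idx (i + 1)), (∀ a, h 0 a = 0) ∧ ∀ i x,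
      lc (α (i + 1)) x = lc (C.diff (i + 1)) (lc (h (i + 1)) x) + lc (h i) (lc (C.diff i) x) := by
  -- The invariant that keeps the recursion going: `α - h ∘ d` has values in the kernel, hence by
  -- exactness in the image of the next differential.
  let Good : ∀ i, (C.idx i → Free n K (C.idx (i + 1))) → Prop := fun i h =>
    ∀ x, lc (C.diff i) (lc (α (i + 1)) x - lc h (lc (C.diff i) x)) = 0
  have hstep : ∀ (i : ℕ) (h : {h : C.idx i → Free n K (C.idx (i + 1)) // Good i h}),
      ∃ h' : C.idx (i + 1) → Free n K (C.idx (i + 2)), Good (i + 1) h' ∧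
        ∀ x, lc (α (i + 1)) x = lc (C.diff (i + 1)) (lc h' x) + lc h.1 (lc (C.diff i) x) := by
    rintro i ⟨h, hh⟩
    have h1 : ∀ a, ∃ y, lc (C.diff (i + 1)) y = α (i + 1) a - lc h (C.diff i a) := by
      intro a
      have h2 := hh (Finsupp.single a 1)
      rw [← LinearMap.mem_ker, ← hC.exact i, Finsupp.linearCombination_single,
        Finsupp.linearCombination_single, one_smul, one_smul] at h2
      exact h2
    choose h' hh' using h1
    have h3 : ∀ x, lc (C.diff (i + 1)) (lc h' x) =
        lc (α (i + 1)) x - lc h (lc (C.diff i) x) := by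
      intro x
      rw [← linearCombination_comp, ← linearCombination_comp, ← linearCombination_sub_fun]
      simp only [hh']
    refine ⟨h', fun x => ?_, fun x => ?_⟩
    · rw [map_sub, hα, h3, hC.diff_diff, map_zero, sub_zero, sub_self]
    · change _ = _ + lc h _
      rw [h3, sub_add_cancel]
  choose next hnext1 hnext2 using hstep
  have h₀ : Good 0 (fun _ => 0) := by
    intro x
    have : lc (fun _ : C.idx 0 => (0 : Free n K (C.idx 1))) (lc (C.diff 0) x) = 0 := by
      simp [Finsupp.linearCombination_apply]
    rw [this, sub_zero, hα, hα₀]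
  let H : ∀ i, {h : C.idx i → Free n K (C.idx (i + 1)) // Good i h} := fun i =>
    Nat.rec ⟨fun _ => 0, h₀⟩ (fun i h => ⟨next i h, hnext1 i h⟩) i
  exact ⟨fun i => (H i).1, fun _ => rfl, fun i => hnext2 i (H i)⟩

/-- If the differentials out of and into position `i + 1` have no constant coefficients, then
endomorphisms that are the identity in position zero are the identity modulo the variables in
position `i + 1`. -/
theorem constMatrix_mul_eq_one (hC : C.IsExact) [∀ i, Fintype (C.idx i)]
    [∀ i, Fintype (C'.idx i)] [∀ i, DecidableEq (C.idx i)]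
    (φ : ∀ i, C.idx i → Free n K (C'.idx i)) (ψ : ∀ i, C'.idx i → Free n K (C.idx i))
    (hφ : ∀ i x, lc (C'.diff i) (lc (φ (i + 1)) x) = lc (φ i) (lc (C.diff i) x))
    (hψ : ∀ i x, lc (C.diff i) (lc (ψ (i + 1)) x) = lc (ψ i) (lc (C'.diff i) x))
    (h₀ : ∀ x, lc (ψ 0) (lc (φ 0) x) = x) {i : ℕ} (h1 : i = 0 ∨ constMatrix (C.diff i) = 0)
    (h2 : constMatrix (C.diff (i + 1)) = 0) :
    constMatrix (ψ (i + 1)) * constMatrix (φ (i + 1)) = 1 := by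
  let α : ∀ i, C.idx i → Free n K (C.idx i) := fun i a =>
    Finsupp.single a 1 - lc (ψ i) (φ i a)
  have hα : ∀ i x, lc (α i) x = x - lc (ψ i) (lc (φ i) x) := by
    intro i x
    rw [linearCombination_sub_fun, linearCombination_single_one, linearCombination_comp]
  -- Here `1 - ψφ` is written as `dh + hd`. Modulo the variables `dh` vanishes by `h2`, and `hd`
  -- vanishes by `h1`, or because `h 0 = 0` when `i = 0`.
  obtain ⟨h, hzero, hh⟩ := exists_homotopy hC α (fun x => by rw [hα, h₀, sub_self]) (fun i x => by
    rw [hα, hα, map_sub, hψ, hφ])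
  have key : constMatrix (fun a => lc (ψ (i + 1)) (φ (i + 1) a)) = 1 := by
    rw [← constMatrix_single (n := n)]
    ext b a
    have h3 := hh i (Finsupp.single a 1)
    simp only [Finsupp.linearCombination_single, one_smul] at h3
    have h4 := congrArg (fun f : Free n K (C.idx (i + 1)) => constantCoeff (f b)) h3
    have h5 : constantCoeff (lc (C.diff (i + 1)) (h (i + 1) a) b) = 0 := by
      have := congrFun (congrFun (constMatrix_comp (C.diff (i + 1)) (h (i + 1))) b) a
      rwa [h2, Matrix.zero_mul] at this
    have h6 : constantCoeff (lc (h i) (C.diff i a) b) = 0 := by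
      have := congrFun (congrFun (constMatrix_comp (h i) (C.diff i)) b) a
      rcases h1 with rfl | h1
      · have h0 : constMatrix (h 0) = 0 := by
          ext b a
          simp [constMatrix, hzero]
        rwa [h0, Matrix.zero_mul] at this
      · rwa [h1, Matrix.mul_zero] at this
    simp only [α, Finsupp.add_apply, Finsupp.sub_apply, map_add, map_sub, h5, h6,
      add_zero, sub_eq_zero] at h4
    exact h4.symm
  rw [← key, constMatrix_comp]

/-! ### Matrices over the field that respect degrees -/

/-- Nonzero entries of `A` join equal degrees only, so the summation index of the product may be
restricted to the fibre. -/
theorem submatrix_mul_submatrix_fiber {α β : Type*} [Fintype α] [Fintype β] [DecidableEq α]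
    {f : α → ℤ} {g : β → ℤ} {A : Matrix β α K} {B : Matrix α β K}
    (hA : ∀ b a, A b a ≠ 0 → g b = f a) (hBA : B * A = 1) (j : ℤ) :
    (B.submatrix (Subtype.val : {a // f a = j} → α) (Subtype.val : {b // g b = j} → β)) *
      (A.submatrix (Subtype.val : {b // g b = j} → β) (Subtype.val : {a // f a = j} → α)) =
      1 := by
  ext a a'
  have h1 : (B * A) a.1 a'.1 = (1 : Matrix α α K) a.1 a'.1 := by rw [hBA]
  rw [Matrix.mul_apply] at h1 ⊢
  rw [Matrix.one_apply] at h1 ⊢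
  simp only [Subtype.ext_iff, ← h1, Matrix.submatrix_apply]
  rw [← Finset.sum_subtype (Finset.univ.filter fun b => g b = j) (by simp)
    (fun b => B a.1 b * A b a'.1)]
  refine Finset.sum_subset (Finset.subset_univ _) fun b _ hb => ?_
  have hb' : A b a'.1 = 0 := by
    by_contra hc
    exact hb (Finset.mem_filter.2 ⟨Finset.mem_univ _, (hA b _ hc).trans a'.2⟩)
  rw [hb', mul_zero]

/-- Mutually inverse matrices that respect degrees: the numbers of rows and columns of each degree
agree. -/
theorem card_fiber_eq {α β : Type*} [Fintype α] [Fintype β] [DecidableEq α] [DecidableEq β]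
    {f : α → ℤ} {g : β → ℤ} {A : Matrix β α K} {B : Matrix α β K}
    (hA : ∀ b a, A b a ≠ 0 → g b = f a) (hB : ∀ a b, B a b ≠ 0 → f a = g b)
    (hAB : A * B = 1) (hBA : B * A = 1) (j : ℤ) :
    Nat.card {a // f a = j} = Nat.card {b // g b = j} := by
  rw [Nat.card_eq_fintype_card, Nat.card_eq_fintype_card]
  exact Matrix.square_of_invertible _ _ (submatrix_mul_submatrix_fiber hA hBA j)
    (submatrix_mul_submatrix_fiber hB hAB j)

theorem constMatrix_graded {d : ι → ℤ} {κ : Type} {e : κ → ℤ} {v : κ → Free n K ι}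
    (hv : ∀ a, v a ∈ gradedPiece d (e a)) (b : ι) (a : κ) (h : constMatrix v b a ≠ 0) :
    d b = e a :=
  deg_eq_of_constantCoeff_ne_zero (hv a) h

end AugSequence

/-! ### Comparison of two resolutions of the same module -/

namespace FreeSequence

local notation "lc" => Finsupp.linearCombination (Poly n K)

/-- A sequence of graded free modules with its augmentation. -/
def toAug (C : FreeSequence n K ι) (d : ι → ℤ) : AugSequence n K where
  idx
    | 0 => ι
    | i + 1 => C.idx i
  deg
    | 0 => d
    | i + 1 => C.deg i
  diff
    | 0 => C.aug
    | i + 1 => C.diff i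

variable {C C' : FreeSequence n K ι} {d : ι → ℤ} {M : Submodule (Poly n K) (Free n K ι)}

theorem IsResolution.isExact (hC : C.IsResolution d M) : (C.toAug d).IsExact where
  homogeneous
    | 0 => hC.aug_homogeneous
    | i + 1 => hC.diff_homogeneous i
  exact
    | 0 => hC.exact_zero
    | i + 1 => hC.exact_succ i

theorem IsResolution.isLift (hC : C.IsResolution d M) (hC' : C'.IsResolution d M) :
    AugSequence.IsLift (C.toAug d) (C'.toAug d) 0
      (fun a : ι => (Finsupp.single a 1 : Free n K ι)) where
  homogeneous a := by
    have h := toFree_mem_gradedPiece (n := n) (K := K) d (a, 0)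
    have h1 : termDeg d ((a, 0) : Term n ι) = d a := by simp [termDeg]
    rw [h1] at h
    exact h
  map_range x := by
    change lc (fun a : ι => (Finsupp.single a 1 : Free n K ι)) (C.augMap x) ∈
      LinearMap.range C'.augMap
    rw [linearCombination_single_one, hC'.range_aug, ← hC.range_aug]
    exact LinearMap.mem_range_self _ x

/-- Two resolutions of the same module are connected by graded maps, and their composition in
position `k` is the identity modulo the variables if the neighbouring differentials of the source
have no constant coefficients. -/
theorem IsResolution.exists_comparison [Finite ι] (hC : C.IsResolution d M)
    (hC' : C'.IsResolution d M) :
    ∃ (φ : ∀ i, C.idx i → Free n K (C'.idx i)) (ψ : ∀ i, C'.idx i → Free n K (C.idx i)),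
      (∀ i a, φ i a ∈ gradedPiece (C'.deg i) (C.deg i a)) ∧
      (∀ i a, ψ i a ∈ gradedPiece (C.deg i) (C'.deg i a)) ∧
      (∀ i x, C'.diffMap i (lc (φ (i + 1)) x) = lc (φ i) (C.diffMap i x)) ∧
      ∀ [∀ i, Fintype (C.idx i)] [∀ i, Fintype (C'.idx i)] [∀ i, DecidableEq (C.idx i)]
        [∀ i, DecidableEq (C'.idx i)] (k : ℕ),
        ((∀ i, i + 1 = k → constMatrix (C.diff i) = 0) → constMatrix (C.diff k) = 0 →
          constMatrix (ψ k) * constMatrix (φ k) = 1) ∧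
        ((∀ i, i + 1 = k → constMatrix (C'.diff i) = 0) → constMatrix (C'.diff k) = 0 →
          constMatrix (φ k) * constMatrix (ψ k) = 1) := by
  classical
  obtain ⟨φ, hφ0, hφ1, hφ2⟩ := AugSequence.exists_lift hC.isExact hC'.isExact (hC.isLift hC')
  obtain ⟨ψ, hψ0, hψ1, hψ2⟩ := AugSequence.exists_lift hC'.isExact hC.isExact (hC'.isLift hC)
  -- With the augmentation included, position zero is the ambient free module, where both maps are
  -- the identity; position `i` of the resolution is position `i + 1` there.
  refine ⟨fun i => φ (i + 1), fun i => ψ (i + 1), fun i => hφ1 (i + 1), fun i => hψ1 (i + 1),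
    fun i => hφ2 (i + 1), ?_⟩
  intro _ _ _ _ k
  have := Fintype.ofFinite ι
  let f1 : ∀ i, Fintype ((C.toAug d).idx i)
    | 0 => inferInstanceAs (Fintype ι)
    | i + 1 => inferInstanceAs (Fintype (C.idx i))
  let f2 : ∀ i, Fintype ((C'.toAug d).idx i)
    | 0 => inferInstanceAs (Fintype ι)
    | i + 1 => inferInstanceAs (Fintype (C'.idx i))
  let e1 : ∀ i, DecidableEq ((C.toAug d).idx i)
    | 0 => inferInstanceAs (DecidableEq ι)
    | i + 1 => inferInstanceAs (DecidableEq (C.idx i))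
  let e2 : ∀ i, DecidableEq ((C'.toAug d).idx i)
    | 0 => inferInstanceAs (DecidableEq ι)
    | i + 1 => inferInstanceAs (DecidableEq (C'.idx i))
  have h0 : ∀ x : Free n K ι, lc (ψ 0) (lc (φ 0) x) = x := by
    intro x
    rw [hφ0, hψ0]
    exact (congrArg _ (linearCombination_single_one x)).trans (linearCombination_single_one x)
  have h0' : ∀ x : Free n K ι, lc (φ 0) (lc (ψ 0) x) = x := by
    intro x
    rw [hφ0, hψ0]
    exact (congrArg _ (linearCombination_single_one x)).trans (linearCombination_single_one x)
  constructor
  · intro h1 h2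
    refine AugSequence.constMatrix_mul_eq_one hC.isExact φ ψ hφ2 hψ2 h0 (i := k) ?_ h2
    cases k with
    | zero => exact Or.inl rfl
    | succ k => exact Or.inr (h1 k rfl)
  · intro h1 h2
    refine AugSequence.constMatrix_mul_eq_one hC'.isExact ψ φ hψ2 hφ2 h0' (i := k) ?_ h2
    cases k with
    | zero => exact Or.inl rfl
    | succ k => exact Or.inr (h1 k rfl)

/-- Resolutions without constant coefficients next to position `k` have the same ranks there. -/
theorem IsResolution.rank_eq [Finite ι] (hC : C.IsResolution d M) (hC' : C'.IsResolution d M)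
    {k : ℕ} (h1 : ∀ i, i + 1 = k → constMatrix (C.diff i) = 0)
    (h2 : constMatrix (C.diff k) = 0) (h1' : ∀ i, i + 1 = k → constMatrix (C'.diff i) = 0)
    (h2' : constMatrix (C'.diff k) = 0) (j : ℤ) : C.rank k j = C'.rank k j := by
  classical
  obtain ⟨φ, ψ, hφ, hψ, -, h⟩ := hC.exists_comparison hC'
  let : ∀ i, Fintype (C.idx i) := fun i => @Fintype.ofFinite _ (hC.finite i)
  let : ∀ i, Fintype (C'.idx i) := fun i => @Fintype.ofFinite _ (hC'.finite i)
  exact AugSequence.card_fiber_eq (AugSequence.constMatrix_graded (hφ k))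
    (AugSequence.constMatrix_graded (hψ k)) ((h k).2 h1' h2') ((h k).1 h1 h2) j

theorem IsMinimalResolution.constMatrix_eq_zero (hC : C.IsMinimalResolution d M) (i : ℕ) :
    constMatrix (C.diff i) = 0 := by
  ext b a
  exact (not_isUnit_iff (hC.diff_homogeneous i a) b).1 (hC.minimal i a b)

/-- If a resolution has in position `k` the ranks of a minimal resolution, then the differential
into position `k` has no constant coefficients. -/
theorem IsResolution.constMatrix_eq_zero_of_rank_eq [Finite ι] (hC : C.IsResolution d M)
    (hC' : C'.IsMinimalResolution d M) {k : ℕ} (hk : ∀ j, C'.rank k j = C.rank k j) :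
    constMatrix (C.diff k) = 0 := by
  classical
  obtain ⟨φ, ψ, hφ, hψ, hcomm, h⟩ := hC.exists_comparison hC'.toIsResolution
  let : ∀ i, Fintype (C.idx i) := fun i => @Fintype.ofFinite _ (hC.finite i)
  let : ∀ i, Fintype (C'.idx i) := fun i => @Fintype.ofFinite _ (hC'.finite i)
  have hfib : ∀ j, Nonempty ({b // C'.deg k b = j} ≃ {a // C.deg k a = j}) := fun j =>
    Finite.card_eq.1 (hk j)
  have hequiv : C'.idx k ≃ C.idx k :=
    (Equiv.sigmaFiberEquiv (C'.deg k)).symm.trans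
      ((Equiv.sigmaCongrRight fun j => (hfib j).some).trans
        (Equiv.sigmaFiberEquiv (C.deg k)))
  have h1 := (h k).2 (fun i _ => hC'.constMatrix_eq_zero i) (hC'.constMatrix_eq_zero k)
  -- Minimality of `C'` yields only a one-sided inverse; equal sizes make it two-sided, so the
  -- constant matrix of `φ k` can be cancelled from the equation `h3`.
  have h2 := (Matrix.mul_eq_one_comm_of_card_eq _ _ _ (Fintype.card_congr hequiv)).1 h1
  have h3 : constMatrix (φ k) * constMatrix (C.diff k) = 0 := by
    rw [← constMatrix_comp]
    have h4 : ∀ a, lc (φ k) (C.diff k a) = lc (C'.diff k) (φ (k + 1) a) := by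
      intro a
      have := hcomm k (Finsupp.single a 1)
      simp only [diffMap, Finsupp.linearCombination_single, one_smul] at this
      exact this.symm
    simp only [h4]
    rw [constMatrix_comp, hC'.constMatrix_eq_zero, Matrix.zero_mul]
  rw [← Matrix.one_mul (constMatrix (C.diff k)), ← h2, Matrix.mul_assoc, h3, Matrix.mul_zero]

end FreeSequence

/-! ### Existence of minimal graded free resolutions -/

section Existence

variable {n : ℕ} {K : Type*} [Field K] {κ μ : Type}

local notation "lc" => Finsupp.linearCombination (Poly n K)

/-- A submodule generated by its homogeneous elements. -/
def IsHomogeneouslyGenerated (d : κ → ℤ) (Z : Submodule (Poly n K) (Free n K κ)) : Prop :=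
  Z ≤ Submodule.span (Poly n K) {f | f ∈ Z ∧ ∃ s, f ∈ gradedPiece d s}

theorem isHomogeneouslyGenerated_span_range {d : κ → ℤ} {e : μ → ℤ} {v : μ → Free n K κ}
    (hv : ∀ a, v a ∈ gradedPiece d (e a)) :
    IsHomogeneouslyGenerated d (Submodule.span (Poly n K) (Set.range v)) := by
  rw [IsHomogeneouslyGenerated, Submodule.span_le]
  rintro _ ⟨a, rfl⟩
  exact Submodule.subset_span ⟨Submodule.subset_span ⟨a, rfl⟩, e a, hv a⟩

theorem isHomogeneouslyGenerated_ker {d : κ → ℤ} {e : μ → ℤ} {v : μ → Free n K κ}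
    (hv : ∀ a, v a ∈ gradedPiece d (e a)) :
    IsHomogeneouslyGenerated e (LinearMap.ker (lc v)) := by
  intro h hh
  obtain ⟨S, hS⟩ := exists_sum_homComp e h
  rw [hS]
  refine Submodule.sum_mem _ fun s _ => Submodule.subset_span ⟨?_, s, homComp_mem e s h⟩
  rw [LinearMap.mem_ker] at hh ⊢
  rw [linearCombination_homComp hv, hh, map_zero]

/-- `v` is a finite family of homogeneous generators. -/
structure IsHomogeneousGenerators (d : κ → ℤ) (Z : Submodule (Poly n K) (Free n K κ)) (e : μ → ℤ)
    (v : μ → Free n K κ) : Prop where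
  homogeneous : ∀ a, v a ∈ gradedPiece d (e a)
  span_eq : Submodule.span (Poly n K) (Set.range v) = Z

/-- The polynomial ring is Noetherian, and a finite generating set can be selected among the
homogeneous elements. -/
theorem exists_homogeneousGenerators [Finite κ] {d : κ → ℤ}
    {Z : Submodule (Poly n K) (Free n K κ)} (hZ : IsHomogeneouslyGenerated d Z) :
    ∃ r, ∃ (e : Fin r → ℤ) (v : Fin r → Free n K κ), IsHomogeneousGenerators d Z e v := by
  have hspan : Submodule.span (Poly n K) {f | f ∈ Z ∧ ∃ s, f ∈ gradedPiece d s} = Z :=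
    le_antisymm (Submodule.span_le.2 fun f hf => hf.1) hZ
  obtain ⟨S, hS, hS'⟩ := (Submodule.fg_span_iff_fg_span_finset_subset _).1
    (IsNoetherian.noetherian (Submodule.span (Poly n K) {f | f ∈ Z ∧ ∃ s, f ∈ gradedPiece d s}))
  have hdeg : ∀ a : Fin S.card, ∃ s, (S.equivFin.symm a : Free n K κ) ∈ gradedPiece d s :=
    fun a => (hS (S.equivFin.symm a).2).2
  choose e he using hdeg
  refine ⟨S.card, e, fun a => S.equivFin.symm a, he, ?_⟩
  rw [← hspan, hS']
  congr 1
  ext f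
  constructor
  · rintro ⟨a, rfl⟩
    exact (S.equivFin.symm a).2
  · intro hf
    exact ⟨S.equivFin ⟨f, hf⟩, by simp⟩

/-- A homogeneous generator with a constant coefficient in a relation is redundant. -/
theorem mem_span_of_constantCoeff_ne_zero [Finite μ] {d : κ → ℤ} {e : μ → ℤ}
    {v : μ → Free n K κ} (hv : ∀ a, v a ∈ gradedPiece d (e a)) {h : Free n K μ}
    (hh : lc v h = 0) {a : μ} (ha : constantCoeff (h a) ≠ 0) :
    v a ∈ Submodule.span (Poly n K) (v '' {a}ᶜ) := by
  classical
  have := Fintype.ofFinite μ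
  -- The component of degree `e a` is still a relation and keeps the constant coefficient at `a`,
  -- but its entry at `a` is now a scalar and can be inverted.
  obtain ⟨h', hh'⟩ : ∃ h', h' = homComp e (e a) h := ⟨_, rfl⟩
  have hmem : h' ∈ gradedPiece e (e a) := hh' ▸ homComp_mem e (e a) h
  have hlc : lc v h' = 0 := by
    rw [hh', linearCombination_homComp hv, hh, map_zero]
  have hcoeff : constantCoeff (h' a) ≠ 0 := by
    rw [constantCoeff_eq, hh', coeff_homComp (by simp [termDeg])]
    exact ha
  rw [Finsupp.linearCombination_apply, Finsupp.sum_fintype _ _ (by simp),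
    Fintype.sum_eq_add_sum_compl a, eq_C_of_constantCoeff_ne_zero hmem hcoeff,
    add_eq_zero_iff_eq_neg] at hlc
  have h1 : (C (constantCoeff (h' a)) : Poly n K) • v a ∈
      Submodule.span (Poly n K) (v '' {a}ᶜ) := by
    rw [hlc]
    refine neg_mem (Submodule.sum_mem _ fun i hi =>
      Submodule.smul_mem _ _ (Submodule.subset_span ⟨i, by simpa using hi, rfl⟩))
  have h2 := Submodule.smul_mem _ (C (constantCoeff (h' a))⁻¹ : Poly n K) h1
  rwa [smul_smul, ← C_mul, inv_mul_cancel₀ hcoeff, C_1, one_smul] at h2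

theorem span_image_compl_singleton {v : μ → Free n K κ} {a : μ}
    (h : v a ∈ Submodule.span (Poly n K) (v '' {a}ᶜ)) :
    Submodule.span (Poly n K) (v '' {a}ᶜ) = Submodule.span (Poly n K) (Set.range v) := by
  refine le_antisymm (Submodule.span_mono (Set.image_subset_range _ _)) ?_
  rw [Submodule.span_le]
  rintro _ ⟨b, rfl⟩
  by_cases hb : b = a
  · exact hb ▸ h
  · exact Submodule.subset_span ⟨b, hb, rfl⟩

theorem IsHomogeneousGenerators.comp_succAbove {d : κ → ℤ}
    {Z : Submodule (Poly n K) (Free n K κ)} {r : ℕ} {e : Fin (r + 1) → ℤ}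
    {v : Fin (r + 1) → Free n K κ} (hv : IsHomogeneousGenerators d Z e v)
    {h : Free n K (Fin (r + 1))} (hh : lc v h = 0) {a : Fin (r + 1)}
    (ha : constantCoeff (h a) ≠ 0) :
    IsHomogeneousGenerators d Z (e ∘ a.succAbove) (v ∘ a.succAbove) := by
  refine ⟨fun i => hv.homogeneous _, ?_⟩
  rw [Set.range_comp, Fin.range_succAbove, span_image_compl_singleton
    (mem_span_of_constantCoeff_ne_zero hv.homogeneous hh ha), hv.span_eq]

/-- A homogeneously generated submodule has homogeneous generators whose relations have no constant
coefficients. -/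
theorem exists_minimal_generators [Finite κ] {d : κ → ℤ}
    {Z : Submodule (Poly n K) (Free n K κ)} (hZ : IsHomogeneouslyGenerated d Z) :
    ∃ r, ∃ (e : Fin r → ℤ) (v : Fin r → Free n K κ), IsHomogeneousGenerators d Z e v ∧
      ∀ h, lc v h = 0 → ∀ a, constantCoeff (h a) = 0 := by
  classical
  have hex := exists_homogeneousGenerators hZ
  -- Take as few homogeneous generators as possible; a relation with a constant coefficient would
  -- allow one to be dropped.
  obtain ⟨r, hr⟩ : ∃ r, r = Nat.find hex := ⟨_, rfl⟩
  obtain ⟨e, v, hv⟩ : ∃ (e : Fin r → ℤ) (v : Fin r → Free n K κ),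
    IsHomogeneousGenerators d Z e v := hr ▸ Nat.find_spec hex
  refine ⟨_, e, v, hv, fun h hh a => ?_⟩
  by_contra ha
  cases r with
  | zero => exact a.elim0
  | succ r =>
    refine Nat.find_min hex (m := r) (by omega) ⟨_, _, hv.comp_succAbove hh ha⟩

variable (n K) in
/-- Homogeneous generators without constant coefficients in their relations. -/
structure MinimalStage where
  base : Type
  baseDeg : base → ℤ
  idx : Type
  finite : Finite idx
  deg : idx → ℤ
  elt : idx → Free n K base
  homogeneous : ∀ a, elt a ∈ gradedPiece baseDeg (deg a)
  minimal : ∀ h, lc elt h = 0 → ∀ a, constantCoeff (h a) = 0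

theorem MinimalStage.exists_next (S : MinimalStage n K) :
    ∃ r, ∃ (e : Fin r → ℤ) (v : Fin r → Free n K S.idx),
      IsHomogeneousGenerators S.deg (LinearMap.ker (lc S.elt)) e v ∧
      ∀ h, lc v h = 0 → ∀ a, constantCoeff (h a) = 0 :=
  have := S.finite
  exists_minimal_generators (isHomogeneouslyGenerated_ker S.homogeneous)

/-- Minimal generators of the module of relations. -/
def MinimalStage.next (S : MinimalStage n K) : MinimalStage n K where
  base := S.idx
  baseDeg := S.deg
  idx := Fin S.exists_next.choose
  finite := inferInstance
  deg := S.exists_next.choose_spec.choose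
  elt := S.exists_next.choose_spec.choose_spec.choose
  homogeneous := S.exists_next.choose_spec.choose_spec.choose_spec.1.homogeneous
  minimal := S.exists_next.choose_spec.choose_spec.choose_spec.2

theorem MinimalStage.range_next (S : MinimalStage n K) :
    LinearMap.range (Finsupp.linearCombination (Poly n K)
      (S.next.elt : S.next.idx → Free n K S.idx)) = LinearMap.ker (lc S.elt) := by
  rw [Finsupp.range_linearCombination]
  exact S.exists_next.choose_spec.choose_spec.choose_spec.1.span_eq

theorem MinimalStage.linearCombination_next (S : MinimalStage n K) (a : S.next.idx) :
    lc S.elt (S.next.elt a : Free n K S.idx) = 0 :=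
  LinearMap.mem_ker.1 (S.range_next.le ⟨Finsupp.single a 1, by
    rw [Finsupp.linearCombination_single, one_smul]⟩)

/-- The iterated modules of relations. -/
def MinimalStage.iter (S : MinimalStage n K) : ℕ → MinimalStage n K
  | 0 => S
  | t + 1 => (S.iter t).next

/-- The resolution obtained by iterating minimal generators of modules of relations. -/
def MinimalStage.resolution (S : MinimalStage n K) : FreeSequence n K S.base where
  idx t := (S.iter t).idx
  deg t := (S.iter t).deg
  aug := S.elt
  diff t := (S.iter (t + 1)).elt

theorem MinimalStage.isMinimalResolution (S : MinimalStage n K) :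
    S.resolution.IsMinimalResolution S.baseDeg (Submodule.span (Poly n K) (Set.range S.elt)) where
  finite t := (S.iter t).finite
  aug_homogeneous := S.homogeneous
  diff_homogeneous t := (S.iter (t + 1)).homogeneous
  range_aug := Finsupp.range_linearCombination _
  exact_zero := S.range_next
  exact_succ t := (S.iter (t + 1)).range_next
  minimal t a b := by
    intro hunit
    exact constantCoeff_ne_zero_of_isUnit hunit
      ((S.iter t).minimal _ ((S.iter t).linearCombination_next a) b)

/-- Homogeneously generated modules have minimal graded free resolutions. -/
theorem exists_isMinimalResolution [Finite κ] {d : κ → ℤ}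
    {M : Submodule (Poly n K) (Free n K κ)} (hM : IsHomogeneouslyGenerated d M) :
    ∃ C : FreeSequence n K κ, C.IsMinimalResolution d M := by
  obtain ⟨r, e, v, hv, hmin⟩ := exists_minimal_generators hM
  have := MinimalStage.isMinimalResolution
    { base := κ, baseDeg := d, idx := Fin r, finite := inferInstance, deg := e, elt := v,
      homogeneous := hv.homogeneous, minimal := hmin }
  exact ⟨_, hv.span_eq ▸ this⟩

end Existence

section Betti

variable {n : ℕ} {K : Type*} [Field K] {ι : Type}

/-! ### Betti numbers -/

/-- Betti numbers can be computed from any resolution without constant coefficients next to the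
position in question. -/
theorem FreeSequence.IsResolution.bettiNumber_eq [Finite ι] {d : ι → ℤ}
    {M : Submodule (Poly n K) (Free n K ι)} (hM : IsHomogeneouslyGenerated d M)
    {C : FreeSequence n K ι} (hC : C.IsResolution d M) {k : ℕ}
    (h1 : ∀ i, i + 1 = k → constMatrix (C.diff i) = 0) (h2 : constMatrix (C.diff k) = 0)
    (j : ℤ) : bettiNumber d M k j = C.rank k j := by
  have hex := exists_isMinimalResolution hM
  unfold bettiNumber
  rw [dif_pos hex]
  have hmin := hex.choose_spec
  exact hmin.toIsResolution.rank_eq hC (fun i _ => hmin.constMatrix_eq_zero i)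
    (hmin.constMatrix_eq_zero k) h1 h2 j

/-- If a resolution has in position `k` the Betti numbers as ranks, then the differential into
position `k` has no constant coefficients. -/
theorem FreeSequence.IsResolution.constMatrix_eq_zero_of_bettiNumber_eq [Finite ι] {d : ι → ℤ}
    {M : Submodule (Poly n K) (Free n K ι)} (hM : IsHomogeneouslyGenerated d M)
    {C : FreeSequence n K ι} (hC : C.IsResolution d M) {k : ℕ}
    (hk : ∀ j, bettiNumber d M k j = C.rank k j) : constMatrix (C.diff k) = 0 := by
  have hex := exists_isMinimalResolution hM
  refine hC.constMatrix_eq_zero_of_rank_eq hex.choose_spec fun j => ?_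
  rw [← hk j, bettiNumber, dif_pos hex]

/-- Relations between the generators of a resolution without constant coefficients next to
position zero. -/
theorem FreeSequence.IsResolution.constantCoeff_eq_zero {d : ι → ℤ}
    {M : Submodule (Poly n K) (Free n K ι)} {C : FreeSequence n K ι} (hC : C.IsResolution d M)
    (h : constMatrix (C.diff 0) = 0) {z : Free n K (C.idx 0)} (hz : C.augMap z = 0)
    (b : C.idx 0) : constantCoeff (z b) = 0 := by
  rw [← LinearMap.mem_ker, ← hC.exact_zero] at hz
  obtain ⟨x, rfl⟩ := hz
  have hfin := hC.finite 1
  have := Fintype.ofFinite (C.idx (0 + 1))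
  rw [FreeSequence.diffMap, linearCombination_entry, map_sum]
  refine Finset.sum_eq_zero fun a _ => ?_
  have h1 : constantCoeff (C.diff 0 a b) = 0 := congrFun (congrFun h b) a
  rw [map_mul, h1, mul_zero]

end Betti

section UResolution

variable {n : ℕ} {K : Type*} [Field K] {ι : Type}

/-! ### The `U`-resolution -/

/-- A `U`-marked set as a marked family. -/
def markedFamily (d : ι → ℤ) (U : Submodule (Poly n K) (Free n K ι))
    (F : {t : Term n ι // t ∈ pommaretBasis U} → Free n K ι) : MarkedFamily n K where
  base := ι
  baseDeg := d
  idx := {t : Term n ι // t ∈ pommaretBasis U}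
  head := Subtype.val
  elt := F

variable {d : ι → ℤ} {U : Submodule (Poly n K) (Free n K ι)}
  {F : {t : Term n ι // t ∈ pommaretBasis U} → Free n K ι}

theorem toFree_add_mem {t : Term n ι} (ht : t.toFree K ∈ U) (η : Fin (n + 1) →₀ ℕ) :
    Term.toFree K (t.1, η + t.2) ∈ U := by
  rw [← monomial_smul_toFree]
  exact Submodule.smul_mem _ _ ht

theorem IsQuasiStable.toFree_mem (hU : IsQuasiStable U) {t : Term n ι}
    (ht : t ∈ pommaretBasis U) : t.toFree K ∈ U := by
  rw [← hU.isPommaretBasis.span_eq]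
  exact Submodule.subset_span ⟨t, ht, rfl⟩

theorem cones_markedFamily (hU : IsQuasiStable U) :
    (markedFamily d U F).cones = {t : Term n ι | t.toFree K ∈ U} := by
  rw [hU.isPommaretBasis.terms_eq]
  ext t
  constructor
  · rintro ⟨p, hp⟩
    exact Set.mem_iUnion₂.2 ⟨p.1, p.2, hp⟩
  · intro h
    obtain ⟨p, hp, h⟩ := Set.mem_iUnion₂.1 h
    exact ⟨⟨p, hp⟩, h⟩

theorem IsMarkedSet.mem_gradedPiece (hF : IsMarkedSet d U F)
    (t : {t : Term n ι // t ∈ pommaretBasis U}) : F t ∈ gradedPiece d (termDeg d t.1) := by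
  obtain ⟨s, hs⟩ := hF.homogeneous t
  have : termDeg d t.1 = s := hs t.1.1 t.1.2 (by rw [hF.head_coeff]; exact one_ne_zero)
  rwa [this]

/-- The head of `F t` lies in `U`, so it cannot occur in the tail of another element. Thus dropping
an index really makes the generating set smaller. -/
theorem IsMarkedSet.injective (hU : IsQuasiStable U) (hF : IsMarkedSet d U F) :
    Function.Injective F := by
  intro t u h
  by_contra hne
  refine hF.tail u t.1.1 t.1.2 ?_ (hU.toFree_mem t.2)
  rw [← h, Finsupp.sub_apply, coeff_sub, hF.head_coeff, coeff_toFree_of_ne, sub_zero]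
  · exact one_ne_zero
  · exact fun hh => hne (Subtype.ext hh.symm)

theorem IsMarkedBasis.isMarked (hU : IsQuasiStable U) (hF : IsMarkedBasis d U F) :
    (markedFamily d U F).IsMarked where
  finite := inferInstanceAs (Finite {t : Term n ι // t ∈ pommaretBasis U})
  homogeneous := hF.toIsMarkedSet.mem_gradedPiece
  tail p := by
    rw [cones_markedFamily hU]
    exact hF.tail p
  disjoint p q t hp hq := by
    by_contra hne
    exact Set.disjoint_left.1 (hU.isPommaretBasis.disjoint p.2 q.2
      fun h => hne (Subtype.ext h)) hp hq
  upward := by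
    rw [cones_markedFamily hU]
    exact fun t ht η => toFree_add_mem ht η
  span_disjoint := by
    rw [cones_markedFamily hU]
    intro s g hg hs hN
    refine (Submodule.disjoint_def.1 (hF.disjoint s)) g ⟨hg, hs⟩ ?_
    rw [sousEscalierSpan, ← termsIn_eq_span]
    exact fun k α hc => ⟨hN k α hc, hs k α hc⟩

theorem IsMarkedBasis.isResolution (hU : IsQuasiStable U) (hF : IsMarkedBasis d U F) :
    (uResolution d U F).IsResolution d (Submodule.span (Poly n K) (Set.range F)) :=
  (hF.isMarked hU).isResolution

/-- The indices and degrees in the iteration depend on the head terms alone; it remains to group the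
Pommaret basis by minimal variable. -/
theorem rank_uResolution (d : ι → ℤ) (U : Submodule (Poly n K) (Free n K ι))
    (F : {t : Term n ι // t ∈ pommaretBasis U} → Free n K ι) (i : ℕ) (j : ℤ) :
    (uResolution d U F).rank i j = uBetti d U i j := by
  classical
  have hfin : Fintype (markedFamily d U F).idx :=
    inferInstanceAs (Fintype {t : Term n ι // t ∈ pommaretBasis U})
  have hcard := MarkedFamily.card_iterSyzygies i (markedFamily d U F) j
  have hsum : ∑ p : (markedFamily d U F).idx, (if (markedFamily d U F).idxDeg p = j - i then
      (n - (minIndex ((markedFamily d U F).head p).2 : ℕ)).choose i else 0) =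
      ∑ t ∈ pommaretBasis U, if termDeg d t = j - i then
        (n - (minIndex t.2 : ℕ)).choose i else 0 := by
    refine Eq.trans ?_ (Finset.sum_coe_sort (pommaretBasis U) fun t : Term n ι =>
      if termDeg d t = j - i then (n - (minIndex t.2 : ℕ)).choose i else 0)
    exact Finset.sum_congr (Finset.ext fun a =>
      ⟨fun _ => Finset.mem_attach _ a, fun _ => Finset.mem_univ a⟩) fun _ _ => rfl
  have hcount : ∀ q, pommaretCount d U (j - i) q =
      ∑ t ∈ pommaretBasis U, if termDeg d t = j - i ∧ minIndex t.2 = q then 1 else 0 := by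
    intro q
    rw [pommaretCount, ← Finset.card_filter, ← Set.ncard_coe_finset]
    congr 1
    ext t
    simp
  refine hcard.trans (hsum.trans ?_)
  simp only [uBetti, hcount, Finset.mul_sum]
  rw [Finset.sum_comm]
  refine Finset.sum_congr rfl fun t _ => ?_
  split_ifs with h
  · simp [h]
  · simp [h]

theorem constMatrix_eq_zero_iff (hU : IsQuasiStable U) (hF : IsMarkedBasis d U F) (i : ℕ) :
    constMatrix ((uResolution d U F).diff i) = 0 ↔
      ∀ a b, ¬ IsUnit ((uResolution d U F).diff i a b) := by
  constructor
  · intro h a b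
    rw [not_isUnit_iff ((hF.isResolution hU).diff_homogeneous i a)]
    exact congrFun (congrFun h b) a
  · intro h
    ext b a
    exact (not_isUnit_iff ((hF.isResolution hU).diff_homogeneous i a) b).1 (h a b)

/-- Once a differential of the `U`-resolution has no constant coefficients, the same holds for all
the following ones. -/
theorem constMatrix_uResolution (hU : IsQuasiStable U) (hF : IsMarkedBasis d U F) {k : ℕ}
    (h : constMatrix ((uResolution d U F).diff k) = 0) {i : ℕ} (hi : k ≤ i) :
    constMatrix ((uResolution d U F).diff i) = 0 := by
  ext b a
  exact (hF.isMarked hU).constantCoeff_iterSyzygies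
    (fun a b => congrFun (congrFun h b) a) hi a b

theorem isMinimalGeneratingSet_iff (hU : IsQuasiStable U) (hF : IsMarkedBasis d U F) :
    IsMinimalGeneratingSet (Submodule.span (Poly n K) (Set.range F)) (Set.range F) ↔
      constMatrix ((uResolution d U F).diff 0) = 0 := by
  have hres := hF.isResolution hU
  constructor
  · rintro ⟨-, hmin⟩
    ext b a
    by_contra hc
    have hker : Finsupp.linearCombination (Poly n K) F ((uResolution d U F).diff 0 a) = 0 := by
      have h1 : (uResolution d U F).diffMap 0 (Finsupp.single a 1) ∈
          LinearMap.range ((uResolution d U F).diffMap 0) := LinearMap.mem_range_self _ _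
      rw [hres.exact_zero, FreeSequence.diffMap, Finsupp.linearCombination_single, one_smul] at h1
      exact h1
    -- The column `a` is a relation with a nonzero constant coefficient at `b`, so `F b` is
    -- redundant.
    refine hmin (F '' {b}ᶜ) ⟨Set.image_subset_range _ _, fun hsub => ?_⟩
      (span_image_compl_singleton
        (mem_span_of_constantCoeff_ne_zero hF.toIsMarkedSet.mem_gradedPiece hker hc))
    obtain ⟨t, ht, htb⟩ := hsub ⟨b, rfl⟩
    exact ht (hF.toIsMarkedSet.injective hU htb)
  · intro h
    refine ⟨rfl, fun T hT hspan => ?_⟩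
    obtain ⟨_, ⟨t, rfl⟩, ht⟩ := Set.exists_of_ssubset hT
    have hTsub : T ⊆ F '' {t}ᶜ := by
      intro f hf
      obtain ⟨u, rfl⟩ := hT.1 hf
      exact ⟨u, fun hut => ht (by rw [← show u = t from hut]; exact hf), rfl⟩
    have hmem : F t ∈ Submodule.span (Poly n K) (F '' {t}ᶜ) := by
      refine Submodule.span_mono hTsub ?_
      rw [hspan]
      exact Submodule.subset_span ⟨t, rfl⟩
    -- Expressing `F t` by the others gives a relation with entry `1` at `t`, whereas every relation
    -- is a combination of columns without constant coefficients.
    obtain ⟨g, hg, hgt⟩ := (Finsupp.mem_span_image_iff_linearCombination _).1 hmem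
    have hgt0 : g t = 0 := by
      by_contra hc
      exact (Finsupp.mem_supported _ _).1 hg (Finsupp.mem_support_iff.2 hc) rfl
    have hker : Finsupp.linearCombination (Poly n K) F (Finsupp.single t 1 - g) = 0 := by
      rw [map_sub, hgt, Finsupp.linearCombination_single, one_smul, sub_self]
    have h1 : constantCoeff ((Finsupp.single t (1 : Poly n K) - g) t) = 0 :=
      hres.constantCoeff_eq_zero h hker t
    rw [Finsupp.sub_apply, hgt0, Finsupp.single_eq_same, sub_zero, map_one] at h1
    exact one_ne_zero h1

theorem isMinimalResolution_iff (hU : IsQuasiStable U) (hF : IsMarkedBasis d U F) :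
    (uResolution d U F).IsMinimalResolution d (Submodule.span (Poly n K) (Set.range F)) ↔
      constMatrix ((uResolution d U F).diff 0) = 0 :=
  ⟨fun h => h.constMatrix_eq_zero 0, fun h => ⟨hF.isResolution hU, fun i =>
    (constMatrix_eq_zero_iff hU hF i).1 (constMatrix_uResolution hU hF h i.zero_le)⟩⟩

/-! ### The terms of a stable module as a marked basis -/

theorem IsQuasiStable.le_termsIn (hU : IsQuasiStable U) {f : Free n K ι} (hf : f ∈ U) :
    f ∈ termsIn K {t : Term n ι | t.toFree K ∈ U} := by
  rw [← hU.isPommaretBasis.span_eq] at hf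
  induction hf using Submodule.span_induction with
  | mem _ h =>
    obtain ⟨t, ht, rfl⟩ := h
    exact toFree_mem_termsIn (hU.toFree_mem ht)
  | zero => exact zero_mem _
  | add f g _ _ hf hg => exact add_mem hf hg
  | smul p f _ hf =>
    have hup : ∀ t ∈ {t : Term n ι | t.toFree K ∈ U}, ∀ η : Fin (n + 1) →₀ ℕ,
        ((t.1, η + t.2) : Term n ι) ∈ {t : Term n ι | t.toFree K ∈ U} :=
      fun t (ht : t.toFree K ∈ U) η => toFree_add_mem ht η
    exact smul_mem_termsIn hup p hf

theorem span_range_toFree (hU : IsQuasiStable U) :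
    Submodule.span (Poly n K)
      (Set.range fun t : {t : Term n ι // t ∈ pommaretBasis U} => t.1.toFree K) = U := by
  conv_rhs => rw [← hU.isPommaretBasis.span_eq]
  congr 1
  ext f
  constructor
  · rintro ⟨t, rfl⟩
    exact ⟨t.1, t.2, rfl⟩
  · rintro ⟨t, ht, rfl⟩
    exact ⟨⟨t, ht⟩, rfl⟩

/-- The Pommaret basis of a quasi-stable module is a marked basis of that module. -/
theorem IsQuasiStable.isMarkedBasis (d : ι → ℤ) (hU : IsQuasiStable U) :
    IsMarkedBasis d U fun t => t.1.toFree K where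
  homogeneous t := ⟨_, toFree_mem_gradedPiece d t.1⟩
  head_coeff t := coeff_toFree_self t.1
  tail t k β h := by simp at h
  disjoint s := by
    rw [Submodule.disjoint_def]
    rintro f ⟨hf, -⟩ hN
    rw [sousEscalierSpan, ← termsIn_eq_span] at hN
    have hf' : f ∈ U := by
      rw [← span_range_toFree hU]
      exact hf
    refine free_ext fun k α => ?_
    by_contra hc
    exact (hN k α hc).1 (hU.le_termsIn hf' k α hc)
  sup_eq s := by
    rw [span_range_toFree hU]
    refine le_antisymm (sup_le inf_le_right ?_) ?_
    · rw [sousEscalierSpan, ← termsIn_eq_span]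
      exact fun f hf k α hc => (hf k α hc).2
    · rw [gradedPiece_eq_termsIn, termsIn_le_iff]
      intro t ht
      by_cases htU : t.toFree K ∈ U
      · exact Submodule.mem_sup_left ⟨htU, toFree_mem_termsIn ht⟩
      · exact Submodule.mem_sup_right (Submodule.subset_span ⟨t, ⟨htU, ht⟩, rfl⟩)

/-- The Pommaret basis of a stable module is a minimal set of generators. -/
theorem IsStable.isMinimalGeneratingSet (hU : IsStable U) :
    IsMinimalGeneratingSet U
      (Set.range fun t : {t : Term n ι // t ∈ pommaretBasis U} => t.1.toFree K) := by
  refine ⟨span_range_toFree hU.1, fun T hT hspan => ?_⟩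
  obtain ⟨_, ⟨t, rfl⟩, ht⟩ := Set.exists_of_ssubset hT
  -- The terms divisible by a term of `T`. If `T` generates `U`, the omitted term `t` lies in `A`,
  -- against its minimality for divisibility.
  let A : Set (Term n ι) := {u | ∃ v : Term n ι, v.toFree K ∈ T ∧ v.1 = u.1 ∧ v.2 ≤ u.2}
  have hup : ∀ u ∈ A, ∀ η : Fin (n + 1) →₀ ℕ, ((u.1, η + u.2) : Term n ι) ∈ A := by
    rintro u ⟨v, hv, h1, h2⟩ η
    exact ⟨v, hv, h1, h2.trans le_add_self⟩
  have hle : ∀ f ∈ Submodule.span (Poly n K) T, f ∈ termsIn K A := by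
    intro f hf
    induction hf using Submodule.span_induction with
    | mem f h =>
      obtain ⟨v, rfl⟩ := hT.1 h
      exact toFree_mem_termsIn ⟨v.1, h, rfl, le_rfl⟩
    | zero => exact zero_mem _
    | add f g _ _ hf hg => exact add_mem hf hg
    | smul p f _ hf => exact smul_mem_termsIn hup p hf
  have htU : t.1.toFree K ∈ Submodule.span (Poly n K) T := by
    rw [hspan]
    exact hU.1.toFree_mem t.2
  obtain ⟨v, hv, h1, h2⟩ := toFree_mem_termsIn_iff.1 (hle _ htU)
  have hmin : t.1 ∈ monomialBasis U := by
    rw [← hU.2]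
    exact t.2
  have hvU : v.toFree K ∈ U := by
    rw [← hspan]
    exact Submodule.subset_span hv
  rw [hmin.2 v hvU h1 h2] at hv
  exact ht hv

theorem IsMarkedBasis.isHomogeneouslyGenerated (hF : IsMarkedBasis d U F) :
    IsHomogeneouslyGenerated d (Submodule.span (Poly n K) (Set.range F)) :=
  isHomogeneouslyGenerated_span_range hF.toIsMarkedSet.mem_gradedPiece

/-- The Betti numbers of a stable module are the ranks of its `U`-resolution. -/
theorem IsStable.bettiNumber_eq [Finite ι] (d : ι → ℤ) (hU : IsStable U) (i : ℕ) (j : ℤ) :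
    bettiNumber d U i j = uBetti d U i j := by
  have hF := hU.1.isMarkedBasis d
  have hspan := span_range_toFree hU.1
  have h0 : constMatrix ((uResolution d U fun t => t.1.toFree K).diff 0) = 0 := by
    rw [← isMinimalGeneratingSet_iff hU.1 hF, hspan]
    exact hU.isMinimalGeneratingSet
  have hc : ∀ i, constMatrix ((uResolution d U fun t => t.1.toFree K).diff i) = 0 := fun i =>
    constMatrix_uResolution hU.1 hF h0 i.zero_le
  have := (hF.isResolution hU.1).bettiNumber_eq hF.isHomogeneouslyGenerated (k := i)
    (fun i _ => hc i) (hc i) j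
  rwa [hspan, rank_uResolution] at this

/-- If the Betti numbers of `(F)` agree with the ranks of the `U`-resolution in position `k`, then
they agree in all later positions. -/
theorem IsMarkedBasis.bettiNumber_eq_of_le [Finite ι] (hU : IsQuasiStable U)
    (hF : IsMarkedBasis d U F) {k : ℕ}
    (hk : ∀ j, bettiNumber d (Submodule.span (Poly n K) (Set.range F)) k j = uBetti d U k j)
    {i : ℕ} (hi : k ≤ i) (j : ℤ) :
    bettiNumber d (Submodule.span (Poly n K) (Set.range F)) i j = uBetti d U i j := by
  have hM := hF.isHomogeneouslyGenerated
  have hres := hF.isResolution hU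
  have h0 : constMatrix ((uResolution d U F).diff k) = 0 :=
    hres.constMatrix_eq_zero_of_bettiNumber_eq hM fun j => by rw [hk, rank_uResolution]
  -- For `i = k` nothing is known about the map out of position `k`, so the hypothesis itself is
  -- used; for `i > k` the maps on both sides of position `i` are controlled.
  rcases hi.eq_or_lt with rfl | hlt
  · exact hk j
  · rw [hres.bettiNumber_eq hM (fun l hl => constMatrix_uResolution hU hF h0 (by omega))
      (constMatrix_uResolution hU hF h0 hi), rank_uResolution]

end UResolution

end MarkedBases

end

/-! ### The corollary -/

open MarkedBases
theorem mainTheorem5 {K : Type*} [Field K] (n m : ℕ) (d : Fin m → ℤ)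
    (U M : Submodule (Poly n K) (Free n K (Fin m))) (hU : IsQuasiStable U)
    (F : {t : Term n (Fin m) // t ∈ pommaretBasis U} → Free n K (Fin m))
    (hF : IsMarkedBasis d U F)
    (hM : M = Submodule.span (Poly n K) (Set.range F)) :
    ((uResolution d U F).IsMinimalResolution d M ↔
      IsMinimalGeneratingSet M (Set.range F)) ∧
    (∀ k : ℕ, (∀ j : ℤ, bettiNumber d M k j = uBetti d U k j) →
      ∀ i : ℕ, k ≤ i → ∀ j : ℤ, bettiNumber d M i j = uBetti d U i j) ∧
    (IsStable U →
      ∀ k : ℕ, (∀ j : ℤ, bettiNumber d M k j = bettiNumber d U k j) →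
        ∀ i : ℕ, k ≤ i → ∀ j : ℤ, bettiNumber d M i j = bettiNumber d U i j) := by
  subst hM
  refine ⟨(isMinimalResolution_iff hU hF).trans (isMinimalGeneratingSet_iff hU hF).symm,
    fun k hk i hi j => hF.bettiNumber_eq_of_le hU hk hi j, fun hS k hk i hi j => ?_⟩
  rw [hS.bettiNumber_eq]
  exact hF.bettiNumber_eq_of_le hU (fun j => by rw [hk, hS.bettiNumber_eq]) hi j
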